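/- **Proposition (Hitchin pair from a divergent-type 2D symplectic Monge-Ampère equation).** Let $M$ be a smooth 2-dimensional manifold, $\pi:T^*M\to M$ its cotangent bundle and $\Omega=dq_1\wedge dp_1+dq_2\wedge dp_2$ the canonical symplectic form on $T^*M$. A smooth 2-form $\omega$ on $T^*M$ defines the Monge-Ampère operator $\Delta_\omega(f)=(df)^*\omega$ and the symplectic Monge-Ampère equation $\Delta_\omega=0$. Let $\bot:\Omega^3(T^*M)\to\Omega^1(T^*M)$ be the inverse of $\alpha\mapsto\alpha\wedge\Omega$. Suppose that the equation is of divergent type, that is, $\mathcal E(\omega)=d\,\bot\,d\omega=0$. For an open set $W\subset T^*M$ consider the following assertion. $(\ast)_W$ There is a smooth function $\mu$ on $W$ such that, with $\omega'=\omega+\mu\Omega$: * $\omega'$ defines the same Monge-Ampère operator as $\omega$: for every smooth $f$ on an open set $V\subset M$, $\Delta_{\omega'}(f)=\Delta_\omega(f)$ at all $q\in V$ with $df(q)\in W$; * $(\omega',\Omega)$ is a Hitchin pair on $W$: $\Omega$ is symplectic and $d\omega'=0$ on $W$; * let $A$ be defined by $\omega'=\Omega(A\cdot,\cdot)$, let $\tilde\omega=-\Omega((1+A^2)\cdot,\cdot)$,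 and identify a 2-form $\tau$ with the map $X\mapsto\tau(X,\cdot)$. Then $$\mathbb J=\begin{pmatrix}A&\Omega^{-1}\\ \tilde\omega&-A^*\end{pmatrix}$$ is an integrable generalized complex structure on $W$. That is, $\mathbb J$ is a smooth bundle map of $T\oplus T^*$ over $W$; $\mathbb J^2=-1$; $(\mathbb J\cdot,\cdot)=-(\cdot,\mathbb J\cdot)$ for $(X+\xi,Y+\eta)=\frac12(\xi(Y)+\eta(X))$; and the smooth local sections of each of the two eigenbundles of $\mathbb J$ in $(T\oplus T^*)\otimes\mathbb C$ are closed under the Courant bracket $[X+\xi,Y+\eta]=[X,Y]+L_X\eta-L_Y\xi-\frac12 d(\iota_X\eta-\iota_Y\xi)$, extended complex-bilinearly. Then: 1. $(\ast)_W$ holds for every open $W\subset T^*M$ on which every closed smooth 1-form is exact, and for $W=\pi^{-1}(B)$ whenever $B\subset M$ is the domain of a chart of $M$ with convex image in $\mathbb R^2$ (in particular for $W=T^*\mathbb R^2$ if $M=\mathbb R^2$). 2. Every point of $M$ has an open neighbourhood $B$ such that $(\ast)_{\pi^{-1}(B)}$ holds. -/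

import Mathlib

open scoped Manifold ContDiff Topology

noncomputable section

namespace SMAE

/-! ### Linear algebra of alternating forms -/

section Linear

variable {E : Type*} [NormedAddCommGroup E] [NormedSpace ℝ E]

/-- The map `X ↦ ι_X σ = σ(X, ·)` from vectors to covectors given by a 2-form `σ`. -/
def flat (σ : E [⋀^Fin 2]→L[ℝ] ℝ) : E →L[ℝ] (E →L[ℝ] ℝ) :=
  ((ContinuousAlternatingMap.ofSubsingletonLIE (𝕜 := ℝ) (E := E) (F := ℝ)
    (0 : Fin 1)).symm.toContinuousLinearEquiv :
      (E [⋀^Fin 1]→L[ℝ] ℝ) →L[ℝ] (E →L[ℝ] ℝ)) ∘L σ.curryLeft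

theorem flat_apply (σ : E [⋀^Fin 2]→L[ℝ] ℝ) (X Y : E) : flat σ X Y = σ ![X, Y] := by
  change σ _ = σ _
  congr 1
  ext i
  fin_cases i <;> rfl

/-- The exterior product `α ∧ Ω` of a covector and a 2-form:
`(α ∧ Ω)(X, Y, Z) = α(X) Ω(Y, Z) - α(Y) Ω(X, Z) + α(Z) Ω(X, Y)`. -/
def wedge (α : E →L[ℝ] ℝ) (Ω : E [⋀^Fin 2]→L[ℝ] ℝ) : E [⋀^Fin 3]→L[ℝ] ℝ :=
  ContinuousAlternatingMap.alternatizeUncurryFin (α.smulRight Ω)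

theorem wedge_apply (α : E →L[ℝ] ℝ) (Ω : E [⋀^Fin 2]→L[ℝ] ℝ) (X Y Z : E) :
    wedge α Ω ![X, Y, Z] = α X * Ω ![Y, Z] - α Y * Ω ![X, Z] + α Z * Ω ![X, Y] := by
  have h1 : (1 : Fin 3).removeNth ![X, Y, Z] = ![X, Z] := by
    ext i; fin_cases i <;> rfl
  have h2 : (2 : Fin 3).removeNth ![X, Y, Z] = ![X, Y] := by
    ext i; fin_cases i <;> rfl
  have h0 : (0 : Fin 3).removeNth ![X, Y, Z] = ![Y, Z] := by
    ext i; fin_cases i <;> rfl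
  simp [wedge, ContinuousAlternatingMap.alternatizeUncurryFin_apply, Fin.sum_univ_three, h0, h1, h2]
  ring

/-- The operator `⊥` from 3-forms to 1-forms on a 4-dimensional symplectic vector space:
the inverse of the isomorphism `α ↦ α ∧ Ω`. -/
def bot (Ω : E [⋀^Fin 2]→L[ℝ] ℝ) (τ : E [⋀^Fin 3]→L[ℝ] ℝ) : E →L[ℝ] ℝ :=
  Function.invFun (fun α : E →L[ℝ] ℝ => wedge α Ω) τ

/-- The endomorphism `A` with `σ = Ω(A ·, ·)`, for a nondegenerate 2-form `Ω`. -/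
def recursionOp (σ Ω : E [⋀^Fin 2]→L[ℝ] ℝ) : E →L[ℝ] E :=
  (flat Ω).inverse ∘L flat σ

/-- The map `X ↦ ι_X σ̃` of the 2-form `σ̃ = -Ω((1 + A²) ·, ·)`, where `σ = Ω(A ·, ·)`. -/
def tildeFlat (σ Ω : E [⋀^Fin 2]→L[ℝ] ℝ) : E →L[ℝ] (E →L[ℝ] ℝ) :=
  -(flat Ω ∘L (ContinuousLinearMap.id ℝ E + recursionOp σ Ω ∘L recursionOp σ Ω))

/-- The endomorphism `(A, Ω⁻¹; σ̃, -A*)` of `E ⊕ E*`: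
`X + ξ ↦ (A X + Ω⁻¹ ξ) + (ι_X σ̃ - ξ ∘ A)`. -/
def pairMatrix (σ Ω : E [⋀^Fin 2]→L[ℝ] ℝ) :
    (E × (E →L[ℝ] ℝ)) →ₗ[ℝ] (E × (E →L[ℝ] ℝ)) where
  toFun v := (recursionOp σ Ω v.1 + (flat Ω).inverse v.2,
    tildeFlat σ Ω v.1 - v.2 ∘L recursionOp σ Ω)
  map_add' v w := by
    ext <;> simp <;> abel
  map_smul' c v := by
    ext <;> simp [mul_sub]

end Linear

/-! ### Differential forms, the Courant bracket and generalized complex structures -/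

section Manifold

variable {E : Type*} [NormedAddCommGroup E] [NormedSpace ℝ E] {H : Type*} [TopologicalSpace H]
  (I : ModelWithCorners ℝ E H) {P : Type*} [TopologicalSpace P] [ChartedSpace H P]

/-- Differential `k`-forms on `P` (no regularity required). -/
abbrev DiffForm (P : Type*) [TopologicalSpace P] [ChartedSpace H P] (k : ℕ) :=
  (x : P) → TangentSpace I x [⋀^Fin k]→L[ℝ] ℝ

/-- Fields of covectors, that is 1-forms, as linear forms on the tangent spaces. -/
abbrev CovectorField (P : Type*) [TopologicalSpace P] [ChartedSpace H P] :=
  (x : P) → TangentSpace I x →L[ℝ] ℝ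

/-- A field of covectors as a differential form of degree one. -/
def CovectorField.toForm {I : ModelWithCorners ℝ E H} (ξ : CovectorField I P) : DiffForm I P 1 :=
  fun x => ContinuousAlternatingMap.ofSubsingleton ℝ (TangentSpace I x) ℝ (0 : Fin 1) (ξ x)

variable {I} in
/-- The expression of a form in the preferred chart `φ` at `x₀`: the pullback `(φ⁻¹)^* σ`. -/
def DiffForm.inChart {k : ℕ} (σ : DiffForm I P k) (x₀ : P) : E → E [⋀^Fin k]→L[ℝ] ℝ :=
  fun y => (σ ((extChartAt I x₀).symm y)).compContinuousLinearMap
    (mfderivWithin 𝓘(ℝ, E) I (extChartAt I x₀).symm (Set.range I) y)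

variable {I} in
/-- Smoothness on an open set `W`: all local expressions of the form are smooth there. -/
def DiffForm.SmoothOn {k : ℕ} (σ : DiffForm I P k) (W : Set P) : Prop :=
  ∀ x₀ : P, ContDiffOn ℝ ∞ (σ.inChart x₀)
    ((extChartAt I x₀).target ∩ (extChartAt I x₀).symm ⁻¹' W)

variable {I} in
/-- The exterior derivative, computed at `x` in the preferred chart at `x`. -/
def DiffForm.d {k : ℕ} (σ : DiffForm I P k) : DiffForm I P (k + 1) :=
  fun x => (extDerivWithin (σ.inChart x) (Set.range I)
    (extChartAt I x x)).compContinuousLinearMap (mfderiv I 𝓘(ℝ, E) (extChartAt I x) x)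

variable {I} in
def DiffForm.ClosedOn {k : ℕ} (σ : DiffForm I P k) (W : Set P) : Prop :=
  ∀ x ∈ W, σ.d x = 0

/-- The differential of a function as a field of covectors. -/
def dFun (f : P → ℝ) : CovectorField I P := fun x => mfderiv I 𝓘(ℝ, ℝ) f x

/-- `H¹_dR(W) = 0`: every closed smooth 1-form on the open set `W` is the differential of a smooth
function on `W`. -/
def FirstDeRhamVanishes (W : Set P) : Prop :=
  ∀ α : CovectorField I P, α.toForm.SmoothOn W → α.toForm.ClosedOn W →
    ∃ f : P → ℝ, ContMDiffOn I 𝓘(ℝ, ℝ) ∞ f W ∧ ∀ x ∈ W, α x = dFun I f x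

variable {I} in
/-- The interior product `ι_X τ = τ(X, ·)` of a 2-form with a vector field. -/
def interior (X : (x : P) → TangentSpace I x) (τ : DiffForm I P 2) : CovectorField I P :=
  fun x => flat (E := E) (τ x) (X x)

variable {I} in
/-- The Lie derivative `L_X η = ι_X dη + d(ι_X η)` of a 1-form along a vector field. -/
def lieDerivative (X : (x : P) → TangentSpace I x) (η : CovectorField I P) : CovectorField I P :=
  fun x => interior X η.toForm.d x + dFun I (fun y => η y (X y)) x

/-- The fibre at `x` of `T ⊕ T*`. -/
abbrev GenFiber (x : P) : Type _ := TangentSpace I x × (TangentSpace I x →L[ℝ] ℝ)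

/-- Sections of `T ⊕ T*` (no regularity required). -/
abbrev GenSection (P : Type*) [TopologicalSpace P] [ChartedSpace H P] := (x : P) → GenFiber I x

variable {I} in
/-- Smooth sections of `T ⊕ T*` over an open set `U`: the vector field and the 1-form are smooth. -/
def GenSection.SmoothOn [IsManifold I 1 P] (s : GenSection I P) (U : Set P) : Prop :=
  ContMDiffOn I I.tangent ∞ (fun x => (⟨x, (s x).1⟩ : TangentBundle I P)) U ∧
    DiffForm.SmoothOn (CovectorField.toForm (I := I) (fun x => (s x).2)) U

variable {I} in
/-- The inner product `(X + ξ, Y + η) = (ξ(Y) + η(X)) / 2` on `T ⊕ T*`. -/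
def genInner {x : P} (u v : GenFiber I x) : ℝ := (1 / 2) * (u.2 v.1 + v.2 u.1)

variable {I} in
/-- The Courant bracket
`[X + ξ, Y + η] = [X, Y] + L_X η - L_Y ξ - (1/2) d(ι_X η - ι_Y ξ)`. -/
def courant (s t : GenSection I P) : GenSection I P := fun x =>
  (VectorField.mlieBracket I (fun y => (s y).1) (fun y => (t y).1) x,
    lieDerivative (fun y => (s y).1) (fun y => (t y).2) x
      - lieDerivative (fun y => (t y).1) (fun y => (s y).2) x
      - (1 / 2 : ℝ) • dFun I (fun y => (t y).2 (s y).1 - (s y).2 (t y).1) x)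

variable {I} in
/-- The complex section `s + i t` of `(T ⊕ T*) ⊗ ℂ` takes its values over `U` in the eigenspace of
`J` for the eigenvalue `ε i`, with `ε = 1` or `ε = -1`: `J (s + i t) = ε i (s + i t)`. -/
def InEigenspace (J : (x : P) → GenFiber I x →ₗ[ℝ] GenFiber I x) (ε : ℝ)
    (s t : GenSection I P) (U : Set P) : Prop :=
  ∀ x ∈ U, J x (s x) = -(ε • t x) ∧ J x (t x) = ε • s x

/-- `J` is an almost generalized complex structure on the open set `W`: a smooth bundle map of
`T ⊕ T*` with `J² = -1` that is skew for the inner product. -/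
structure IsAlmostGenComplexOn [IsManifold I 1 P]
    (J : (x : P) → GenFiber I x →ₗ[ℝ] GenFiber I x) (W : Set P) : Prop where
  smooth : ∀ U : Set P, IsOpen U → U ⊆ W → ∀ s : GenSection I P, s.SmoothOn U →
    GenSection.SmoothOn (fun x => J x (s x)) U
  sq : ∀ x ∈ W, ∀ v : GenFiber I x, J x (J x v) = -v
  skew : ∀ x ∈ W, ∀ u v : GenFiber I x, genInner (J x u) v = -genInner u (J x v)

/-- `J` is an (integrable) generalized complex structure on the open set `W`: moreover the smooth
(local) sections of each of its two eigenspaces in `(T ⊕ T*) ⊗ ℂ` are closed under the complex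
bilinear extension of the Courant bracket. The bracket of `s + i t` and `s' + i t'` is
`([s, s'] - [t, t']) + i ([s, t'] + [t, s'])`. -/
structure IsGenComplexOn [IsManifold I 1 P]
    (J : (x : P) → GenFiber I x →ₗ[ℝ] GenFiber I x) (W : Set P) : Prop
    extends IsAlmostGenComplexOn I J W where
  integrable : ∀ ε : ℝ, ε = 1 ∨ ε = -1 → ∀ U : Set P, IsOpen U → U ⊆ W →
    ∀ s t s' t' : GenSection I P,
      s.SmoothOn U → t.SmoothOn U → s'.SmoothOn U → t'.SmoothOn U →
      InEigenspace J ε s t U → InEigenspace J ε s' t' U →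
      InEigenspace J ε (fun x => courant s s' x - courant t t' x)
        (fun x => courant s t' x + courant t s' x) U

/-- `Ω` is a symplectic form on the open set `W`. -/
structure IsSymplecticOn (Ω : DiffForm I P 2) (W : Set P) : Prop where
  smooth : Ω.SmoothOn W
  closed : Ω.ClosedOn W
  nondegenerate : ∀ x ∈ W, ∀ X : TangentSpace I x, (∀ Y : TangentSpace I x, Ω x ![X, Y] = 0) → X = 0

/-- `(σ, Ω)` is a Hitchin pair on the open set `W`: `Ω` is symplectic and `σ` is closed. -/
structure IsHitchinPairOn (σ Ω : DiffForm I P 2) (W : Set P) : Prop where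
  symplectic : IsSymplecticOn I Ω W
  smooth : σ.SmoothOn W
  closed : σ.ClosedOn W

variable {I} in
/-- The bundle map `𝕁 = (A, Ω⁻¹; σ̃, -A*)` of `T ⊕ T*` defined by a pair of 2-forms. -/
def pairStructure (σ Ω : DiffForm I P 2) : (x : P) → GenFiber I x →ₗ[ℝ] GenFiber I x :=
  fun x => pairMatrix (E := E) (σ x) (Ω x)

variable {I} in
/-- The Euler operator `𝓔(σ) = d ⊥ d σ` on the 2-forms of a 4-dimensional symplectic manifold. -/
def eulerOp (Ω σ : DiffForm I P 2) : DiffForm I P 2 :=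
  (CovectorField.toForm (I := I) (fun x => bot (E := E) (Ω x) (σ.d x))).d

end Manifold

/-! ### The phase space and Monge-Ampère operators -/

section PhaseSpace

/-- The model space `ℝ²`. -/
abbrev Plane := EuclideanSpace ℝ (Fin 2)

variable (M : Type*) [TopologicalSpace M] [ChartedSpace Plane M] [IsManifold (𝓡 2) ∞ M]

/-- The cotangent bundle `T*M` of a surface `M`. -/
abbrev Phase := Bundle.TotalSpace (Plane →L[ℝ] ℝ)
  (fun q : M => TangentSpace (𝓡 2) q →L[ℝ] Bundle.Trivial M ℝ q)

/-- The model of the 4-dimensional manifold `T*M`. -/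
abbrev phaseModel := (𝓡 2).prod 𝓘(ℝ, Plane →L[ℝ] ℝ)

/-- The Liouville 1-form `θ = ∑ pᵢ dqᵢ` on `T*M`: `θ_p(v) = p(dπ(v))`. -/
def liouville : CovectorField phaseModel (Phase M) := fun p =>
  (p.2 : TangentSpace (𝓡 2) p.1 →L[ℝ] ℝ) ∘L
    mfderiv phaseModel (𝓡 2) (fun p' : Phase M => p'.1) p

/-- The canonical symplectic form `Ω = -dθ = ∑ dqᵢ ∧ dpᵢ` on `T*M`. -/
def canonicalForm : DiffForm phaseModel (Phase M) 2 := fun p => -((liouville M).toForm.d p)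

variable {M}

/-- The section `df : M → T*M`. -/
def dSection (f : M → ℝ) : M → Phase M := fun q => ⟨q, dFun (𝓡 2) f q⟩

/-- The Monge-Ampère operator `Δ_σ(f) = (df)^* σ`. -/
def mongeAmpere (σ : DiffForm phaseModel (Phase M) 2) (f : M → ℝ) : DiffForm (𝓡 2) M 2 := fun q =>
  (σ (dSection f q)).compContinuousLinearMap (mfderiv (𝓡 2) phaseModel (dSection f) q)

/-- The equation `Δ_σ = 0` is of divergent type: `𝓔(σ) = 0`. -/
def IsDivergentType (σ : DiffForm phaseModel (Phase M) 2) : Prop :=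
  eulerOp (canonicalForm M) σ = 0

/-- Over the open set `W ⊆ T*M` the equation `Δ_σ = 0` gives a Hitchin pair: for some smooth
function `μ` on `W`, the form `σ' = σ + μ Ω` defines the same Monge-Ampère operator as `σ` and is
closed, so that `(σ', Ω)` is a Hitchin pair, and the matrix `𝕁` of the pair `(σ', Ω)` is an
integrable generalized complex structure on `W`. -/
def GivesHitchinPairOn (σ : DiffForm phaseModel (Phase M) 2) (W : Set (Phase M)) : Prop :=
  ∃ μ : Phase M → ℝ, ContMDiffOn phaseModel 𝓘(ℝ, ℝ) ∞ μ W ∧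
    ∃ σ' : DiffForm phaseModel (Phase M) 2, (∀ p, σ' p = σ p + μ p • canonicalForm M p) ∧
      (∀ V : Set M, IsOpen V → ∀ f : M → ℝ, ContMDiffOn (𝓡 2) 𝓘(ℝ, ℝ) ∞ f V →
        ∀ q ∈ V, dSection f q ∈ W → mongeAmpere σ' f q = mongeAmpere σ f q) ∧
      IsHitchinPairOn phaseModel σ' (canonicalForm M) W ∧
      IsGenComplexOn phaseModel (pairStructure σ' (canonicalForm M)) W

end PhaseSpace

end SMAE

end

/-! In dimension 4 the map `α ↦ α ∧ Ω` from covectors to 3-forms is an isomorphism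
(`wedge_injective`, `wedge_surjective`), so `dσ = α ∧ Ω` with `α = ⊥dσ`, and divergent type says
precisely that `dα = 0`. Where `α = dg`, the form `σ' = σ - gΩ` is closed: `dσ' = dσ - dg ∧ Ω = 0`,
because `dΩ = 0`. Hence `μ = -g`, and the set `W` matters only for the exactness of `α`.

The Monge-Ampère operator does not change, because graphs of differentials are Lagrangian: the
Liouville form satisfies `(df)^*θ = df`, so `(df)^*Ω = -d(df) = 0` (`mongeAmpere_canonicalForm`).

Integrability holds for every Hitchin pair (`IsHitchinPairOn.isGenComplexOn`). The shear `X + ξ ↦ X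
+ (ξ + ι_X σ)` conjugates `𝕁` to `(0, Ω⁻¹; -Ω, 0)`, which explains the algebraic identities. The
`εi`-eigenbundle is the graph of the complex 2-form `-σ + iεΩ`, and the graph of a closed 2-form is
closed under the Courant bracket (`halfCourant_closed`, `halfCourant_graph`).

Exactness of `α` is the assumption in the de Rham case. Over a chart with convex image, canonical
coordinates identify `W` with a convex open set and the Poincaré lemma applies
(`exists_eq_dFun_of_convex`). Balls inside charts give the local statement.

Two facts carry the passage to coordinates: `d` commutes with pullback (`extDeriv_pull`), and `Ω`
has the same constant coefficients in all preferred charts of `T*M` (`canonicalForm_inChart`). -/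

noncomputable section

namespace SMAE

/-! ### Linear algebra of a pair of 2-forms and of its matrix -/

section LinearAlgebra

variable {E : Type*} [NormedAddCommGroup E] [NormedSpace ℝ E]

theorem flat_swap (σ : E [⋀^Fin 2]→L[ℝ] ℝ) (X Y : E) : flat σ X Y = -flat σ Y X := by
  rw [flat_apply, flat_apply]
  have h := σ.toAlternatingMap.map_swap ![X, Y] (i := 0) (j := 1) (by decide)
  have h2 : (![X, Y] ∘ Equiv.swap (0 : Fin 2) 1) = ![Y, X] := by
    ext i; fin_cases i <;> rfl
  rw [h2] at h
  change σ ![Y, X] = -σ ![X, Y] at h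
  rw [h, neg_neg]

theorem form_ext {σ τ : E [⋀^Fin 2]→L[ℝ] ℝ} (h : flat σ = flat τ) : σ = τ := by
  ext v
  have hv : v = ![v 0, v 1] := by ext i; fin_cases i <;> rfl
  rw [hv, ← flat_apply, ← flat_apply, h]

/-- The map `σ ↦ flat σ` as a continuous linear map. -/
def flatL : (E [⋀^Fin 2]→L[ℝ] ℝ) →L[ℝ] (E →L[ℝ] (E →L[ℝ] ℝ)) :=
  LinearMap.mkContinuous
    { toFun := flat
      map_add' := fun σ τ => by ext X Y; simp [flat_apply]
      map_smul' := fun c σ => by ext X Y; simp [flat_apply] } 1 (fun σ => by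
    refine ContinuousLinearMap.opNorm_le_bound _ (by positivity) fun X => ?_
    refine ContinuousLinearMap.opNorm_le_bound _ (by positivity) fun Y => ?_
    change ‖flat σ X Y‖ ≤ _
    rw [flat_apply]
    refine (σ.le_opNorm _).trans (le_of_eq ?_)
    simp [Fin.prod_univ_two, mul_assoc])

@[simp] theorem flatL_apply (σ : E [⋀^Fin 2]→L[ℝ] ℝ) : flatL σ = flat σ := rfl

theorem hasFDerivAt_flat (σ : E [⋀^Fin 2]→L[ℝ] ℝ) :
    HasFDerivAt (fun τ : E [⋀^Fin 2]→L[ℝ] ℝ => flat τ) (flatL (E := E)) σ :=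
  ContinuousLinearMap.hasFDerivAt (F := E →L[ℝ] (E →L[ℝ] ℝ)) (flatL (E := E))

theorem contDiff_flat {n : WithTop ℕ∞} :
    ContDiff ℝ n (fun τ : E [⋀^Fin 2]→L[ℝ] ℝ => flat τ) := by
  have h : ContDiff ℝ n (flatL (E := E)) :=
    ContinuousLinearMap.contDiff (F := E →L[ℝ] (E →L[ℝ] ℝ)) _
  exact h

theorem flat_compContinuousLinearMap {E' : Type*} [NormedAddCommGroup E'] [NormedSpace ℝ E']
    (σ : E [⋀^Fin 2]→L[ℝ] ℝ) (f : E' →L[ℝ] E) (X Y : E') :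
    flat (σ.compContinuousLinearMap f) X Y = flat σ (f X) (f Y) := by
  rw [flat_apply, flat_apply]
  change σ _ = σ _
  congr 1
  ext i; fin_cases i <;> rfl

/-- Nondegeneracy is injectivity of `flat Ω`, and `E` and its dual have equal dimension.
`IsInvertible` is the form needed because `ContinuousLinearMap.inverse` takes a default value
elsewhere. -/
theorem flat_isInvertible [FiniteDimensional ℝ E] {Ω : E [⋀^Fin 2]→L[ℝ] ℝ}
    (h : ∀ X, (∀ Y, Ω ![X, Y] = 0) → X = 0) : (flat Ω).IsInvertible := by
  have hinj : Function.Injective (flat Ω : E →ₗ[ℝ] (E →L[ℝ] ℝ)) := by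
    rw [injective_iff_map_eq_zero]
    intro X hX
    refine h X fun Y => ?_
    rw [← flat_apply]
    exact congrArg (fun l : E →L[ℝ] ℝ => l Y) hX
  have hfin : Module.finrank ℝ E = Module.finrank ℝ (E →L[ℝ] ℝ) := by
    rw [← (LinearMap.toContinuousLinearMap : (E →ₗ[ℝ] ℝ) ≃ₗ[ℝ] (E →L[ℝ] ℝ)).finrank_eq]
    exact (Subspace.dual_finrank_eq (K := ℝ) (V := E)).symm
  refine ⟨(LinearEquiv.ofInjectiveOfFinrankEq (flat Ω : E →ₗ[ℝ] (E →L[ℝ] ℝ)) hinj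
    hfin).toContinuousLinearEquiv, ?_⟩
  ext X Y
  rfl

theorem flat_inverse_apply {Ω : E [⋀^Fin 2]→L[ℝ] ℝ} (hΩ : (flat Ω).IsInvertible)
    (ξ : E →L[ℝ] ℝ) : flat Ω ((flat Ω).inverse ξ) = ξ :=
  hΩ.self_apply_inverse ξ

theorem inverse_flat_apply {Ω : E [⋀^Fin 2]→L[ℝ] ℝ} (hΩ : (flat Ω).IsInvertible)
    (X : E) : (flat Ω).inverse (flat Ω X) = X :=
  hΩ.inverse_apply_self X

theorem flat_recursionOp (σ : E [⋀^Fin 2]→L[ℝ] ℝ) {Ω : E [⋀^Fin 2]→L[ℝ] ℝ}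
    (hΩ : (flat Ω).IsInvertible) (X : E) : flat Ω (recursionOp σ Ω X) = flat σ X :=
  flat_inverse_apply hΩ _

/-- This removes `A` and `A*` from the matrix. With `N = Ω⁻¹(ι_X σ + ξ)` the image is `(N, -ι_X Ω -
ι_N σ)`: in the variable `η = ξ + ι_X σ` the map is just `(X, η) ↦ (Ω⁻¹ η, -ι_X Ω)`. -/
theorem pairMatrix_apply (σ : E [⋀^Fin 2]→L[ℝ] ℝ) {Ω : E [⋀^Fin 2]→L[ℝ] ℝ}
    (hΩ : (flat Ω).IsInvertible) (v : E × (E →L[ℝ] ℝ)) :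
    pairMatrix σ Ω v = ((flat Ω).inverse (flat σ v.1 + v.2),
      -flat Ω v.1 - flat σ ((flat Ω).inverse (flat σ v.1 + v.2))) := by
  obtain ⟨X, ξ⟩ := v
  refine Prod.ext ?_ ?_
  · simp [pairMatrix, recursionOp]
  · ext Y
    -- `A` is self-adjoint for `Ω`, since both `Ω` and `Ω(A ·, ·)` are alternating; so `A*` becomes
    -- `σ ∘ Ω⁻¹` on covectors.
    have h1 : ξ (recursionOp σ Ω Y) = flat σ ((flat Ω).inverse ξ) Y := by
      conv_lhs => rw [← flat_inverse_apply hΩ ξ]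
      rw [flat_swap, flat_recursionOp σ hΩ, flat_swap, neg_neg]
    simp [pairMatrix, tildeFlat, h1, flat_recursionOp σ hΩ]
    simp [recursionOp]
    ring

theorem pairMatrix_pairMatrix (σ : E [⋀^Fin 2]→L[ℝ] ℝ) {Ω : E [⋀^Fin 2]→L[ℝ] ℝ}
    (hΩ : (flat Ω).IsInvertible) (v : E × (E →L[ℝ] ℝ)) :
    pairMatrix σ Ω (pairMatrix σ Ω v) = -v := by
  rw [pairMatrix_apply σ hΩ v, pairMatrix_apply σ hΩ]
  set N := (flat Ω).inverse (flat σ v.1 + v.2) with hN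
  have hΩN : flat Ω N = flat σ v.1 + v.2 := flat_inverse_apply hΩ _
  have h : (flat Ω).inverse (flat σ N + (-flat Ω v.1 - flat σ N)) = -v.1 := by
    rw [show flat σ N + (-flat Ω v.1 - flat σ N) = flat Ω (-v.1) by rw [map_neg]; abel,
      inverse_flat_apply hΩ]
  refine Prod.ext h ?_
  simp only [h, hΩN, map_neg, Prod.snd_neg]
  abel

theorem pairMatrix_skew (σ : E [⋀^Fin 2]→L[ℝ] ℝ) {Ω : E [⋀^Fin 2]→L[ℝ] ℝ}
    (hΩ : (flat Ω).IsInvertible) (u v : E × (E →L[ℝ] ℝ)) :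
    (pairMatrix σ Ω u).2 v.1 + v.2 (pairMatrix σ Ω u).1 =
      -(u.2 (pairMatrix σ Ω v).1 + (pairMatrix σ Ω v).2 u.1) := by
  rw [pairMatrix_apply σ hΩ u, pairMatrix_apply σ hΩ v]
  set N := (flat Ω).inverse (flat σ u.1 + u.2) with hN
  set N' := (flat Ω).inverse (flat σ v.1 + v.2) with hN'
  -- Expressing the covectors through `N` and `N'` leaves only values of `σ` and `Ω`, which cancel
  -- by antisymmetry.
  have h1 : u.2 = flat Ω N - flat σ u.1 := by
    rw [hN, flat_inverse_apply hΩ]; abel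
  have h2 : v.2 = flat Ω N' - flat σ v.1 := by
    rw [hN', flat_inverse_apply hΩ]; abel
  rw [h1, h2]
  simp only [sub_apply, neg_apply]
  rw [flat_swap Ω N' N, flat_swap σ v.1 N, flat_swap σ u.1 N', flat_swap Ω u.1 v.1]
  ring

/-- The right-hand side is the real and imaginary part of `ξ = ι_X(-σ + iεΩ)` for `X + ξ = s + it`:
the eigenspace is the graph of a complex 2-form. -/
theorem pairMatrix_eigen_iff (σ : E [⋀^Fin 2]→L[ℝ] ℝ) {Ω : E [⋀^Fin 2]→L[ℝ] ℝ}
    (hΩ : (flat Ω).IsInvertible) {ε : ℝ} (hε : ε * ε = 1) (s t : E × (E →L[ℝ] ℝ)) :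
    (pairMatrix σ Ω s = -(ε • t) ∧ pairMatrix σ Ω t = ε • s) ↔
      (s.2 = -(ε • flat Ω t.1) - flat σ s.1 ∧ t.2 = ε • flat Ω s.1 - flat σ t.1) := by
  rw [pairMatrix_apply σ hΩ s, pairMatrix_apply σ hΩ t]
  constructor
  · rintro ⟨h1, h2⟩
    have h1' := congrArg (fun v => flat Ω (Prod.fst v)) h1
    have h2' := congrArg (fun v => flat Ω (Prod.fst v)) h2
    simp only [flat_inverse_apply hΩ, Prod.fst_neg, Prod.smul_fst, map_neg, map_smul] at h1' h2'
    rw [← h1', ← h2']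
    constructor <;> abel
  · rintro ⟨h1, h2⟩
    have e1 : flat σ s.1 + s.2 = flat Ω (-(ε • t.1)) := by
      rw [h1, map_neg, map_smul]; abel
    have e2 : flat σ t.1 + t.2 = flat Ω (ε • s.1) := by
      rw [h2, map_smul]; abel
    rw [e1, e2, inverse_flat_apply hΩ, inverse_flat_apply hΩ]
    refine ⟨Prod.ext rfl ?_, Prod.ext rfl ?_⟩
    · simp only [Prod.snd_neg, Prod.smul_snd, h2, map_neg, map_smul, smul_sub, smul_smul, hε,
        one_smul]
      abel
    · simp only [Prod.smul_snd, h1, map_smul, smul_sub, smul_neg, smul_smul, hε, one_smul]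

end LinearAlgebra

/-! ### Smooth pullback of alternating forms; the isomorphism `α ↦ α ∧ Ω` -/

section Alternating

variable {E : Type*} [NormedAddCommGroup E] [NormedSpace ℝ E]
  {F : Type*} [NormedAddCommGroup F] [NormedSpace ℝ F]

/-- Alternatization of multilinear maps, as a continuous linear map. -/
def alternatizationL (E : Type*) [NormedAddCommGroup E] [NormedSpace ℝ E] (k : ℕ) :
    ContinuousMultilinearMap ℝ (fun _ : Fin k => E) ℝ →L[ℝ] (E [⋀^Fin k]→L[ℝ] ℝ) :=
  LinearMap.mkContinuous
    { toFun := fun f => ContinuousMultilinearMap.alternatization f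
      map_add' := fun f g => map_add _ f g
      map_smul' := fun c f => by
        ext v
        simp [ContinuousMultilinearMap.alternatization_apply_apply, Finset.mul_sum, Units.smul_def,
          mul_left_comm] }
    -- The bound is `k!`: there is one term of norm at most `‖f‖ ∏ ‖v i‖` for each permutation.
    (Fintype.card (Equiv.Perm (Fin k))) (fun f => by
      refine ContinuousAlternatingMap.opNorm_le_bound _ (by positivity) fun v => ?_
      change ‖ContinuousMultilinearMap.alternatization f v‖ ≤ _
      rw [ContinuousMultilinearMap.alternatization_apply_apply]
      refine (norm_sum_le _ _).trans ?_
      have : ∀ s ∈ (Finset.univ : Finset (Equiv.Perm (Fin k))),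
          ‖Equiv.Perm.sign s • f (v ∘ s)‖ ≤ ‖f‖ * ∏ i, ‖v i‖ := by
        intro s _
        have h1 : ‖Equiv.Perm.sign s • f (v ∘ s)‖ = ‖f (v ∘ s)‖ := by
          rcases Int.units_eq_one_or (Equiv.Perm.sign s) with h | h <;> simp [h]
        rw [h1]
        refine (f.le_opNorm _).trans (le_of_eq ?_)
        rw [← Equiv.prod_comp s (fun i => ‖v i‖)]
        rfl
      refine (Finset.sum_le_sum this).trans (le_of_eq ?_)
      simp [mul_assoc])

theorem alternatizationL_apply (k : ℕ) (τ : E [⋀^Fin k]→L[ℝ] ℝ) :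
    alternatizationL E k τ.toContinuousMultilinearMap = (k.factorial : ℝ) • τ := by
  ext v
  change ContinuousMultilinearMap.alternatization τ.toContinuousMultilinearMap v = _
  rw [ContinuousMultilinearMap.alternatization_apply_apply]
  have : ∀ s ∈ (Finset.univ : Finset (Equiv.Perm (Fin k))),
      Equiv.Perm.sign s • τ.toContinuousMultilinearMap (v ∘ s) = τ v := by
    intro s _
    have h := τ.toAlternatingMap.map_perm v s
    change τ (v ∘ s) = Equiv.Perm.sign s • τ v at h
    change Equiv.Perm.sign s • τ (v ∘ s) = τ v
    rw [h, smul_smul, Int.units_mul_self, one_smul]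
  rw [Finset.sum_congr rfl this]
  simp [Fintype.card_perm]

/-- The pullback of alternating forms is smooth in the form and in the linear map. -/
theorem contDiff_compContinuousLinearMap (k : ℕ) {n : WithTop ℕ∞} :
    ContDiff ℝ n (fun q : (F [⋀^Fin k]→L[ℝ] ℝ) × (E →L[ℝ] F) =>
      q.1.compContinuousLinearMap q.2) := by
  -- The pullback equals `(1/k!)` times the alternatization of the multilinear pullback, which is
  -- linear in the form and continuous multilinear in the copies of the linear map.
  have h : (fun q : (F [⋀^Fin k]→L[ℝ] ℝ) × (E →L[ℝ] F) => q.1.compContinuousLinearMap q.2) =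
      fun q => ((k.factorial : ℝ)⁻¹) • alternatizationL E k
        (ContinuousMultilinearMap.compContinuousLinearMapContinuousMultilinear ℝ
          (fun _ : Fin k => E) (fun _ : Fin k => F) ℝ (fun _ => q.2)
          (ContinuousAlternatingMap.toContinuousMultilinearMapCLM ℝ q.1)) := by
    ext1 q
    have h1 : ContinuousMultilinearMap.compContinuousLinearMapContinuousMultilinear ℝ
          (fun _ : Fin k => E) (fun _ : Fin k => F) ℝ (fun _ => q.2)
          (ContinuousAlternatingMap.toContinuousMultilinearMapCLM ℝ q.1) =
        (q.1.compContinuousLinearMap q.2).toContinuousMultilinearMap := by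
      ext v; rfl
    rw [h1, alternatizationL_apply, smul_smul, inv_mul_cancel₀ (by positivity), one_smul]
  rw [h]
  refine ContDiff.const_smul _ ((alternatizationL E k).contDiff.comp ?_)
  refine ContDiff.clm_apply ?_ (ContinuousLinearMap.contDiff _ |>.comp contDiff_fst)
  exact (ContinuousMultilinearMap.contDiff _).comp (contDiff_pi.2 fun _ => contDiff_snd)

/-- Alternating forms embed in the dual of the exterior power. The upper bound on the dimension
suffices for the count in `wedge_surjective`. -/
theorem finiteDimensional_alternating [FiniteDimensional ℝ E] (k : ℕ) :
    FiniteDimensional ℝ (E [⋀^Fin k]→L[ℝ] ℝ) ∧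
      Module.finrank ℝ (E [⋀^Fin k]→L[ℝ] ℝ) ≤ (Module.finrank ℝ E).choose k := by
  let e : (E [⋀^Fin k]→L[ℝ] ℝ) →ₗ[ℝ] (⋀[ℝ]^k E →ₗ[ℝ] ℝ) :=
    (exteriorPower.alternatingMapLinearEquiv (R := ℝ) (n := k) (M := E) (N := ℝ)).toLinearMap ∘ₗ
      (ContinuousAlternatingMap.toAlternatingMapLinear (R := ℝ))
  have he : Function.Injective e :=
    exteriorPower.alternatingMapLinearEquiv.injective.comp
      ContinuousAlternatingMap.toAlternatingMap_injective
  have : FiniteDimensional ℝ (E [⋀^Fin k]→L[ℝ] ℝ) := FiniteDimensional.of_injective e he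
  refine ⟨this, (LinearMap.finrank_le_finrank_of_injective he).trans (le_of_eq ?_)⟩
  rw [← exteriorPower.finrank_eq (R := ℝ) (M := E) (n := k)]
  exact Subspace.dual_finrank_eq

/-- The map `α ↦ α ∧ Ω` as a linear map. -/
def wedgeₗ (Ω : E [⋀^Fin 2]→L[ℝ] ℝ) : (E →L[ℝ] ℝ) →ₗ[ℝ] (E [⋀^Fin 3]→L[ℝ] ℝ) where
  toFun α := wedge α Ω
  map_add' α β := by
    ext v
    have hv : v = ![v 0, v 1, v 2] := by ext i; fin_cases i <;> rfl
    rw [hv, ContinuousAlternatingMap.add_apply, wedge_apply, wedge_apply, wedge_apply]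
    simp only [add_apply]
    ring
  map_smul' c α := by
    ext v
    have hv : v = ![v 0, v 1, v 2] := by ext i; fin_cases i <;> rfl
    rw [hv, ContinuousAlternatingMap.smul_apply, wedge_apply, wedge_apply]
    simp only [smul_apply, smul_eq_mul, RingHom.id_apply]
    ring

@[simp] theorem wedgeₗ_apply (Ω : E [⋀^Fin 2]→L[ℝ] ℝ) (α : E →L[ℝ] ℝ) :
    wedgeₗ Ω α = wedge α Ω := rfl

/-- If `α ∧ Ω = 0` and `α X ≠ 0`, dimension at least 3 gives `Y ≠ 0` killed by both `α` and `Ω(X,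
·)`. Then `(α ∧ Ω)(X, Y, Z) = α(X) Ω(Y, Z)` vanishes for all `Z`, against nondegeneracy. -/
theorem wedge_injective [FiniteDimensional ℝ E] {Ω : E [⋀^Fin 2]→L[ℝ] ℝ}
    (hE : 3 ≤ Module.finrank ℝ E) (hΩ : (flat Ω).IsInvertible) :
    Function.Injective (wedgeₗ Ω) := by
  rw [injective_iff_map_eq_zero]
  intro α hα
  have hw : ∀ X Y Z, α X * flat Ω Y Z - α Y * flat Ω X Z + α Z * flat Ω X Y = 0 := by
    intro X Y Z
    simp only [flat_apply]
    rw [← wedge_apply, ← wedgeₗ_apply, hα]; rfl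
  by_contra hne
  obtain ⟨X, hX⟩ : ∃ X, α X ≠ 0 := by
    by_contra! h
    exact hne (ContinuousLinearMap.ext h)
  obtain ⟨Y, hY, hY0⟩ : ∃ Y : E, (α.toLinearMap.prod (flat Ω X).toLinearMap) Y = 0 ∧ Y ≠ 0 := by
    have hlt : Module.finrank ℝ (ℝ × ℝ) < Module.finrank ℝ E := by
      rw [Module.finrank_prod, Module.finrank_self]; omega
    have := LinearMap.ker_ne_bot_of_finrank_lt (f := α.toLinearMap.prod (flat Ω X).toLinearMap) hlt
    obtain ⟨Y, hY, hY0⟩ := Submodule.exists_mem_ne_zero_of_ne_bot this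
    exact ⟨Y, hY, hY0⟩
  obtain ⟨h1, h2⟩ : α Y = 0 ∧ flat Ω X Y = 0 := by simpa using hY
  refine hY0 ?_
  have h3 : flat Ω Y = 0 := by
    ext Z
    have := hw X Y Z
    rw [h1, h2] at this
    simpa [hX] using this
  rw [← inverse_flat_apply hΩ Y, h3, map_zero]

/-- An injection between spaces of dimension 4 and at most `4.choose 3 = 4`. -/
theorem wedge_surjective [FiniteDimensional ℝ E] {Ω : E [⋀^Fin 2]→L[ℝ] ℝ}
    (hE : Module.finrank ℝ E = 4) (hΩ : (flat Ω).IsInvertible) :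
    Function.Surjective (wedgeₗ Ω) := by
  obtain ⟨hfin, hle⟩ := finiteDimensional_alternating (E := E) 3
  have hinj := wedge_injective (by omega) hΩ
  have hdual : Module.finrank ℝ (E →L[ℝ] ℝ) = 4 := by
    rw [← (LinearMap.toContinuousLinearMap : (E →ₗ[ℝ] ℝ) ≃ₗ[ℝ] (E →L[ℝ] ℝ)).finrank_eq, ← hE]
    exact Subspace.dual_finrank_eq (K := ℝ) (V := E)
  have h4 : Module.finrank ℝ (E →L[ℝ] ℝ) = Module.finrank ℝ (E [⋀^Fin 3]→L[ℝ] ℝ) := by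
    refine le_antisymm (LinearMap.finrank_le_finrank_of_injective hinj) ?_
    rw [hdual]
    refine hle.trans (by rw [hE]; decide)
  exact (LinearMap.injective_iff_surjective_of_finrank_eq_finrank h4).1 hinj

theorem wedge_bot [FiniteDimensional ℝ E] {Ω : E [⋀^Fin 2]→L[ℝ] ℝ}
    (hE : Module.finrank ℝ E = 4) (hΩ : (flat Ω).IsInvertible) (τ : E [⋀^Fin 3]→L[ℝ] ℝ) :
    wedge (bot Ω τ) Ω = τ :=
  Function.invFun_eq (f := fun α : E →L[ℝ] ℝ => wedge α Ω) (wedge_surjective hE hΩ τ)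

/-- `bot` is chosen form by form; a single continuous linear `R` inverting the wedge with a fixed
`Ω` is what gives smoothness of `⊥dσ`. -/
theorem exists_wedge_leftInverse [FiniteDimensional ℝ E] {Ω : E [⋀^Fin 2]→L[ℝ] ℝ}
    (hE : 3 ≤ Module.finrank ℝ E) (hΩ : (flat Ω).IsInvertible) :
    ∃ R : (E [⋀^Fin 3]→L[ℝ] ℝ) →L[ℝ] (E →L[ℝ] ℝ), ∀ α, R (wedge α Ω) = α := by
  have := (finiteDimensional_alternating (E := E) 3).1
  obtain ⟨g, hg⟩ := LinearMap.exists_leftInverse_of_injective (wedgeₗ Ω)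
    (LinearMap.ker_eq_bot.2 (wedge_injective hE hΩ))
  exact ⟨g.toContinuousLinearMap, fun α => LinearMap.congr_fun hg α⟩

theorem wedge_compContinuousLinearMap {E' : Type*} [NormedAddCommGroup E'] [NormedSpace ℝ E']
    (α : E →L[ℝ] ℝ) (Ω : E [⋀^Fin 2]→L[ℝ] ℝ) (f : E' →L[ℝ] E) :
    (wedge α Ω).compContinuousLinearMap f = wedge (α ∘L f) (Ω.compContinuousLinearMap f) := by
  ext v
  have hv : v = ![v 0, v 1, v 2] := by ext i; fin_cases i <;> rfl
  rw [hv, wedge_apply]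
  simp only [← flat_apply, flat_compContinuousLinearMap]
  simp only [flat_apply]
  rw [ContinuousAlternatingMap.compContinuousLinearMap_apply]
  have : (⇑f ∘ ![v 0, v 1, v 2]) = ![f (v 0), f (v 1), f (v 2)] := by
    ext i; fin_cases i <;> rfl
  rw [this, wedge_apply]
  rfl

end Alternating

/-! ### Forms in charts and naturality of the exterior derivative -/

section Charts

theorem two_le_smooth : minSmoothness ℝ 2 ≤ ∞ := by
  rw [minSmoothness_of_isRCLikeNormedField]
  exact WithTop.coe_le_coe.2 (le_top (a := (2 : ℕ∞)))

variable {E : Type*} [NormedAddCommGroup E] [NormedSpace ℝ E] {H : Type*} [TopologicalSpace H]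
  {I : ModelWithCorners ℝ E H} {P : Type*} [TopologicalSpace P] [ChartedSpace H P]
  {E' : Type*} [NormedAddCommGroup E'] [NormedSpace ℝ E']
  {E'' : Type*} [NormedAddCommGroup E''] [NormedSpace ℝ E'']

/-- The derivative of a map from a vector space to a manifold, as a map of model spaces. -/
def tderiv (I : ModelWithCorners ℝ E H) (F : E' → P) (z : E') : E' →L[ℝ] E :=
  mfderiv 𝓘(ℝ, E') I F z

/-- The derivative of a map from a manifold to a vector space, as a map of model spaces. -/
def cderiv (I : ModelWithCorners ℝ E H) (φ : P → E') (x : P) : E →L[ℝ] E' :=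
  mfderiv I 𝓘(ℝ, E') φ x

/-- The pullback of a form by a map from a vector space. -/
def pull {k : ℕ} (F : E' → P) (σ : DiffForm I P k) (z : E') : E' [⋀^Fin k]→L[ℝ] ℝ :=
  let τ : E [⋀^Fin k]→L[ℝ] ℝ := σ (F z)
  τ.compContinuousLinearMap (tderiv I F z)

theorem flat_pull (F : E' → P) (σ : DiffForm I P 2) (z X Y : E') :
    flat (pull F σ z) X Y = flat (E := E) (σ (F z)) (tderiv I F z X) (tderiv I F z Y) :=
  flat_compContinuousLinearMap _ _ _ _

theorem tderiv_comp {F : E'' → P} {g : E' → E''} {z : E'}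
    (hF : MDifferentiableAt 𝓘(ℝ, E'') I F (g z)) (hg : DifferentiableAt ℝ g z) :
    tderiv I (F ∘ g) z = tderiv I F (g z) ∘L fderiv ℝ g z := by
  unfold tderiv
  rw [mfderiv_comp z hF hg.mdifferentiableAt, mfderiv_eq_fderiv]
  rfl

theorem fderiv_comp_eq {F : E' → P} {φ : P → E''} {z : E'}
    (hφ : MDifferentiableAt I 𝓘(ℝ, E'') φ (F z)) (hF : MDifferentiableAt 𝓘(ℝ, E') I F z) :
    fderiv ℝ (φ ∘ F) z = cderiv I φ (F z) ∘L tderiv I F z := by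
  rw [← mfderiv_eq_fderiv]
  exact mfderiv_comp z hφ hF

theorem cderiv_comp {φ : P → E'} {g : E' → E''} {x : P}
    (hg : DifferentiableAt ℝ g (φ x)) (hφ : MDifferentiableAt I 𝓘(ℝ, E') φ x) :
    cderiv I (g ∘ φ) x = fderiv ℝ g (φ x) ∘L cderiv I φ x := by
  unfold cderiv
  rw [mfderiv_comp x hg.mdifferentiableAt hφ, mfderiv_eq_fderiv]
  rfl

theorem tderiv_congr {F G : E' → P} {z : E'} (h : F =ᶠ[𝓝 z] G) : tderiv I F z = tderiv I G z :=
  h.mfderiv_eq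

theorem cderiv_congr {φ ψ : P → E'} {x : P} (h : φ =ᶠ[𝓝 x] ψ) : cderiv I φ x = cderiv I ψ x :=
  h.mfderiv_eq

theorem pull_congr {k : ℕ} {F G : E' → P} {z : E'} (h : F =ᶠ[𝓝 z] G) (σ : DiffForm I P k) :
    pull F σ z = pull G σ z := by
  let σ' : P → E [⋀^Fin k]→L[ℝ] ℝ := σ
  change ContinuousAlternatingMap.compContinuousLinearMap (σ' (F z)) _ =
    ContinuousAlternatingMap.compContinuousLinearMap (σ' (G z)) _
  rw [h.eq_of_nhds, tderiv_congr h]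

theorem pull_comp {k : ℕ} {F : E'' → P} {g : E' → E''} {z : E'} (σ : DiffForm I P k)
    (hF : MDifferentiableAt 𝓘(ℝ, E'') I F (g z)) (hg : DifferentiableAt ℝ g z) :
    pull (F ∘ g) σ z = (pull F σ (g z)).compContinuousLinearMap (fderiv ℝ g z) := by
  unfold pull
  rw [tderiv_comp hF hg]
  rfl

theorem DiffForm.SmoothOn.mono {k : ℕ} {σ : DiffForm I P k} {W U : Set P} (h : σ.SmoothOn W)
    (hU : U ⊆ W) : σ.SmoothOn U :=
  fun x₀ => (h x₀).mono (Set.inter_subset_inter_right _ (Set.preimage_mono hU))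

theorem mdifferentiableAt_chart [IsManifold I ∞ P] {x₀ x : P} (hx : x ∈ (extChartAt I x₀).source) :
    MDifferentiableAt I 𝓘(ℝ, E) (extChartAt I x₀) x := by
  rw [extChartAt_source] at hx
  exact mdifferentiableAt_extChartAt hx

theorem contMDiffAt_chart [IsManifold I ∞ P] {x₀ x : P} (hx : x ∈ (extChartAt I x₀).source) :
    ContMDiffAt I 𝓘(ℝ, E) ∞ (extChartAt I x₀) x := by
  rw [extChartAt_source] at hx
  exact contMDiffAt_extChartAt' hx

theorem contDiffAt_chart_comp [IsManifold I ∞ P] {F : E' → P} {z : E'} {x₀ : P}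
    (hF : ContMDiffAt 𝓘(ℝ, E') I ∞ F z) (hz : F z ∈ (extChartAt I x₀).source) :
    ContDiffAt ℝ ∞ (extChartAt I x₀ ∘ F) z := by
  rw [← contMDiffAt_iff_contDiffAt]
  exact (contMDiffAt_chart hz).comp z hF

section Boundaryless

variable [I.Boundaryless]

theorem inChart_eq_pull {k : ℕ} (σ : DiffForm I P k) (x₀ : P) :
    σ.inChart x₀ = pull (extChartAt I x₀).symm σ := by
  ext1 y
  unfold DiffForm.inChart pull tderiv
  rw [I.range_eq_univ, mfderivWithin_univ]
  rfl

theorem isOpen_chart_preimage (x₀ : P) {W : Set P} (hW : IsOpen W) :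
    IsOpen ((extChartAt I x₀).target ∩ (extChartAt I x₀).symm ⁻¹' W) :=
  (continuousOn_extChartAt_symm x₀).isOpen_inter_preimage (isOpen_extChartAt_target x₀) hW

theorem DiffForm.SmoothOn.contDiffAt {k : ℕ} {σ : DiffForm I P k} {W : Set P} (h : σ.SmoothOn W)
    (hW : IsOpen W) {x₀ : P} {y : E} (hy : y ∈ (extChartAt I x₀).target)
    (hyW : (extChartAt I x₀).symm y ∈ W) : ContDiffAt ℝ ∞ (σ.inChart x₀) y :=
  (h x₀).contDiffAt ((isOpen_chart_preimage x₀ hW).mem_nhds ⟨hy, hyW⟩)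

theorem d_eq {k : ℕ} (σ : DiffForm I P k) (x : P) :
    σ.d x = ContinuousAlternatingMap.compContinuousLinearMap
      (extDeriv (σ.inChart x) (extChartAt I x x)) (cderiv I (extChartAt I x) x) := by
  unfold DiffForm.d cderiv
  rw [I.range_eq_univ, extDerivWithin_univ]
  rfl

variable [IsManifold I ∞ P]

theorem contMDiffAt_chart_symm {x₀ : P} {y : E} (hy : y ∈ (extChartAt I x₀).target) :
    ContMDiffAt 𝓘(ℝ, E) I ∞ (extChartAt I x₀).symm y :=
  (contMDiffOn_extChartAt_symm x₀).contMDiffAt ((isOpen_extChartAt_target x₀).mem_nhds hy)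

theorem mdifferentiableAt_chart_symm {x₀ : P} {y : E} (hy : y ∈ (extChartAt I x₀).target) :
    MDifferentiableAt 𝓘(ℝ, E) I (extChartAt I x₀).symm y :=
  (contMDiffAt_chart_symm hy).mdifferentiableAt (by simp)

theorem cderiv_tderiv_chart {x₀ : P} {y : E} (hy : y ∈ (extChartAt I x₀).target) :
    cderiv I (extChartAt I x₀) ((extChartAt I x₀).symm y) ∘L tderiv I (extChartAt I x₀).symm y =
      ContinuousLinearMap.id ℝ E := by
  rw [← fderiv_comp_eq (mdifferentiableAt_chart ((extChartAt I x₀).map_target hy))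
    (mdifferentiableAt_chart_symm hy)]
  have h : (extChartAt I x₀) ∘ (extChartAt I x₀).symm =ᶠ[𝓝 y] id := by
    filter_upwards [(isOpen_extChartAt_target x₀).mem_nhds hy] with z hz
    exact (extChartAt I x₀).right_inv hz
  rw [h.fderiv_eq, fderiv_id]

theorem tderiv_cderiv_chart {x₀ x : P} (hx : x ∈ (extChartAt I x₀).source) :
    tderiv I (extChartAt I x₀).symm (extChartAt I x₀ x) ∘L cderiv I (extChartAt I x₀) x =
      ContinuousLinearMap.id ℝ E := by
  have hy := (extChartAt I x₀).map_source hx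
  have h := mfderiv_comp x (mdifferentiableAt_chart_symm hy) (mdifferentiableAt_chart hx)
  have h' : (extChartAt I x₀).symm ∘ (extChartAt I x₀) =ᶠ[𝓝 x] id := by
    filter_upwards [(isOpen_extChartAt_source x₀).mem_nhds hx] with z hz
    exact (extChartAt I x₀).left_inv hz
  rw [h'.mfderiv_eq, mfderiv_id] at h
  exact h.symm

/-- Near `z` the map `F` factors as the inverse chart after `chart ∘ F`, so every pullback reduces
to one between vector spaces. -/
theorem pull_eq_inChart {k : ℕ} (σ : DiffForm I P k) {F : E' → P} {z : E'} {x₀ : P}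
    (hF : ContMDiffAt 𝓘(ℝ, E') I 1 F z) (hz : F z ∈ (extChartAt I x₀).source) :
    pull F σ z = (σ.inChart x₀ (extChartAt I x₀ (F z))).compContinuousLinearMap
      (fderiv ℝ (extChartAt I x₀ ∘ F) z) := by
  have h : F =ᶠ[𝓝 z] (extChartAt I x₀).symm ∘ (extChartAt I x₀ ∘ F) := by
    filter_upwards [hF.continuousAt.preimage_mem_nhds
      ((isOpen_extChartAt_source x₀).mem_nhds hz)] with w hw
    exact ((extChartAt I x₀).left_inv hw).symm
  rw [pull_congr h, pull_comp, inChart_eq_pull]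
  · rfl
  · exact mdifferentiableAt_chart_symm ((extChartAt I x₀).map_source hz)
  · rw [← mdifferentiableAt_iff_differentiableAt]
    exact (mdifferentiableAt_chart hz).comp z (hF.mdifferentiableAt one_ne_zero)

section Pullback

variable {k : ℕ} {σ : DiffForm I P k} {W : Set P} {F : E' → P} {U : Set E'} {z : E'}

theorem pull_eventuallyEq (hU : IsOpen U) (hF : ContMDiffOn 𝓘(ℝ, E') I ∞ F U) (hz : z ∈ U)
    {x₀ : P} (hx : F z ∈ (extChartAt I x₀).source) :
    pull F σ =ᶠ[𝓝 z] fun w => (σ.inChart x₀ (extChartAt I x₀ (F w))).compContinuousLinearMap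
      (fderiv ℝ (extChartAt I x₀ ∘ F) w) := by
  have hc : ContinuousAt F z := (hF.contMDiffAt (hU.mem_nhds hz)).continuousAt
  filter_upwards [hU.mem_nhds hz, hc.preimage_mem_nhds
      ((isOpen_extChartAt_source x₀).mem_nhds hx)] with w hwU hw
  exact pull_eq_inChart σ ((hF.contMDiffAt (hU.mem_nhds hwU)).of_le (by simp)) hw

theorem contDiffAt_pull (hσ : σ.SmoothOn W) (hW : IsOpen W) (hU : IsOpen U)
    (hF : ContMDiffOn 𝓘(ℝ, E') I ∞ F U) (hz : z ∈ U) (hzW : F z ∈ W) :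
    ContDiffAt ℝ ∞ (pull F σ) z := by
  have hx := mem_extChartAt_source (I := I) (F z)
  refine ContDiffAt.congr_of_eventuallyEq ?_ (pull_eventuallyEq hU hF hz hx)
  have hc := contDiffAt_chart_comp (hF.contMDiffAt (hU.mem_nhds hz)) hx
  have h1 : ContDiffAt ℝ ∞ (σ.inChart (F z)) (extChartAt I (F z) (F z)) :=
    hσ.contDiffAt hW (mem_extChartAt_target (F z)) (by simpa using hzW)
  have h2 : ContDiffAt ℝ ∞ (fderiv ℝ (extChartAt I (F z) ∘ F)) z :=
    hc.fderiv_right (by simp)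
  exact (contDiff_compContinuousLinearMap k).contDiffAt.comp z
    ((ContDiffAt.comp z (f := extChartAt I (F z) ∘ F) h1 hc).prodMk h2)

/-- Naturality of `d`: near `z` the pullback is that of the local expression of `σ` by `chart ∘ F`,
and `d` commutes with pullback between vector spaces. -/
theorem extDeriv_pull (hσ : σ.SmoothOn W) (hW : IsOpen W) (hU : IsOpen U)
    (hF : ContMDiffOn 𝓘(ℝ, E') I ∞ F U) (hz : z ∈ U) (hzW : F z ∈ W) :
    extDeriv (pull F σ) z = pull F σ.d z := by
  have hx := mem_extChartAt_source (I := I) (F z)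
  have hFz := hF.contMDiffAt (hU.mem_nhds hz)
  rw [(pull_eventuallyEq hU hF hz hx).extDeriv_eq]
  have hc := contDiffAt_chart_comp hFz hx
  have h1 : ContDiffAt ℝ ∞ (σ.inChart (F z)) (extChartAt I (F z) (F z)) :=
    hσ.contDiffAt hW (mem_extChartAt_target (F z)) (by simpa using hzW)
  have := extDeriv_pullback (f := extChartAt I (F z) ∘ F) (x := z)
    (h1.differentiableAt (by simp)) hc two_le_smooth
  refine this.trans ?_
  unfold pull
  rw [d_eq, fderiv_comp_eq (mdifferentiableAt_chart hx) (hFz.mdifferentiableAt (by simp))]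
  rfl

end Pullback

variable {k : ℕ} {σ : DiffForm I P k} {W : Set P}

/-- `DiffForm.d` uses a different chart at each point; naturality for the inverse chart at `x₀`
shows that this one chart computes it on its whole domain. -/
theorem d_inChart (hσ : σ.SmoothOn W) (hW : IsOpen W) {x₀ : P} {y : E}
    (hy : y ∈ (extChartAt I x₀).target) (hyW : (extChartAt I x₀).symm y ∈ W) :
    σ.d.inChart x₀ y = extDeriv (σ.inChart x₀) y := by
  rw [inChart_eq_pull, inChart_eq_pull, extDeriv_pull hσ hW (isOpen_extChartAt_target x₀)
    (contMDiffOn_extChartAt_symm x₀) hy hyW]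

theorem DiffForm.SmoothOn.d (hσ : σ.SmoothOn W) (hW : IsOpen W) : σ.d.SmoothOn W := by
  intro x₀
  have h : ContDiffOn ℝ ∞ (extDeriv (σ.inChart x₀))
      ((extChartAt I x₀).target ∩ (extChartAt I x₀).symm ⁻¹' W) := by
    intro y hy
    refine ContDiffAt.contDiffWithinAt ?_
    have := (hσ.contDiffAt hW hy.1 hy.2).fderiv_right (m := ∞) (by simp)
    exact (ContinuousAlternatingMap.alternatizeUncurryFinCLM ℝ E ℝ).contDiff.contDiffAt.comp y this
  exact h.congr fun y hy => d_inChart hσ hW hy.1 hy.2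

theorem eq_zero_of_inChart {σ : DiffForm I P k} {x : P}
    (h : σ.inChart x (extChartAt I x x) = 0) : σ x = 0 := by
  have hx := mem_extChartAt_source (I := I) x
  have h1 := cderiv_tderiv_chart (I := I) (mem_extChartAt_target (I := I) x)
  have h2 := tderiv_cderiv_chart hx
  let σ' : P → E [⋀^Fin k]→L[ℝ] ℝ := σ
  rw [inChart_eq_pull] at h
  have h3 : (σ' ((extChartAt I x).symm (extChartAt I x x))).compContinuousLinearMap
    (tderiv I (extChartAt I x).symm (extChartAt I x x)) = 0 := h
  rw [(extChartAt I x).left_inv hx] at h3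
  have h4 := congrArg (fun τ : E [⋀^Fin k]→L[ℝ] ℝ =>
    τ.compContinuousLinearMap (cderiv I (extChartAt I x) x)) h3
  change σ' x = 0
  have h5 : ((σ' x).compContinuousLinearMap
      (tderiv I (extChartAt I x).symm (extChartAt I x x))).compContinuousLinearMap
        (cderiv I (extChartAt I x) x) = σ' x := by
    ext v
    change σ' x (fun i => (tderiv I (extChartAt I x).symm (extChartAt I x x) ∘L
      cderiv I (extChartAt I x) x) (v i)) = _
    rw [h2]; rfl
  rw [← h5]
  refine h4.trans ?_
  ext v; rfl

theorem DiffForm.ClosedOn.extDeriv_inChart (hσ : σ.SmoothOn W) (hW : IsOpen W) {x₀ : P}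
    (h : σ.ClosedOn W) {y : E}
    (hy : y ∈ (extChartAt I x₀).target) (hyW : (extChartAt I x₀).symm y ∈ W) :
    extDeriv (σ.inChart x₀) y = 0 := by
  rw [← d_inChart hσ hW hy hyW, inChart_eq_pull]
  unfold pull
  rw [h _ hyW]
  ext v; rfl

end Boundaryless

end Charts

/-! ### The Courant bracket in a vector space -/

section FlatCourant

variable {E : Type*} [NormedAddCommGroup E] [NormedSpace ℝ E]

theorem extDeriv_one_apply {η : E → E →L[ℝ] ℝ} {u : E} (hη : DifferentiableAt ℝ η u) (A B : E) :
    flat (extDeriv (fun w => ContinuousAlternatingMap.ofSubsingleton ℝ E ℝ (0 : Fin 1) (η w)) u)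
      A B = fderiv ℝ η u A B - fderiv ℝ η u B A := by
  let e : (E →L[ℝ] ℝ) →L[ℝ] (E [⋀^Fin 1]→L[ℝ] ℝ) :=
    (ContinuousAlternatingMap.ofSubsingletonLIE (𝕜 := ℝ) (E := E) (F := ℝ)
      (0 : Fin 1)).toContinuousLinearEquiv
  have h : HasFDerivAt (fun w => ContinuousAlternatingMap.ofSubsingleton ℝ E ℝ (0 : Fin 1) (η w))
      (e ∘L fderiv ℝ η u) u := e.hasFDerivAt.comp u hη.hasFDerivAt
  rw [flat_apply, extDeriv, h.fderiv, ContinuousAlternatingMap.alternatizeUncurryFin_apply,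
    Fin.sum_univ_two]
  have h0 : (e ∘L fderiv ℝ η u) A ((0 : Fin 2).removeNth ![A, B]) = fderiv ℝ η u A B := rfl
  have h1 : (e ∘L fderiv ℝ η u) B ((1 : Fin 2).removeNth ![A, B]) = fderiv ℝ η u B A := rfl
  simp only [Matrix.cons_val_zero, Matrix.cons_val_one, h0, h1]
  simp
  ring

theorem extDeriv_two_apply (τ : E → E [⋀^Fin 2]→L[ℝ] ℝ) (u A B C : E) :
    extDeriv τ u ![A, B, C] = flat (fderiv ℝ τ u A) B C - flat (fderiv ℝ τ u B) A C
      + flat (fderiv ℝ τ u C) A B := by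
  have h1 : (1 : Fin 3).removeNth ![A, B, C] = ![A, C] := by
    ext i; fin_cases i <;> rfl
  have h2 : (2 : Fin 3).removeNth ![A, B, C] = ![A, B] := by
    ext i; fin_cases i <;> rfl
  have h0 : (0 : Fin 3).removeNth ![A, B, C] = ![B, C] := by
    ext i; fin_cases i <;> rfl
  simp only [flat_apply]
  simp [extDeriv, ContinuousAlternatingMap.alternatizeUncurryFin_apply, Fin.sum_univ_three,
    h0, h1, h2]
  ring

/-- The half `L_X η - (1/2) d(ι_X η)` of the 1-form part of the Courant bracket, in a vector
space. -/
def halfCourant (X : E → E) (η : E → E →L[ℝ] ℝ) (u : E) : E →L[ℝ] ℝ :=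
  -- The first two terms are `L_X η` in coordinates.
  fderiv ℝ η u (X u) + η u ∘L fderiv ℝ X u - (1 / 2 : ℝ) • fderiv ℝ (fun w => η w (X w)) u

theorem halfCourant_congr {X : E → E} {η η' : E → E →L[ℝ] ℝ} {u : E} (h : η =ᶠ[𝓝 u] η') :
    halfCourant X η u = halfCourant X η' u := by
  have h2 : (fun w => η w (X w)) =ᶠ[𝓝 u] fun w => η' w (X w) := by
    filter_upwards [h] with w hw
    rw [hw]
  unfold halfCourant
  rw [h.fderiv_eq, h.eq_of_nhds, h2.fderiv_eq]

theorem halfCourant_apply {X : E → E} {η : E → E →L[ℝ] ℝ} {u : E} (hX : DifferentiableAt ℝ X u)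
    (hη : DifferentiableAt ℝ η u) (Z : E) :
    halfCourant X η u Z = fderiv ℝ η u (X u) Z + η u (fderiv ℝ X u Z)
      - (1 / 2) * (η u (fderiv ℝ X u Z) + fderiv ℝ η u Z (X u)) := by
  unfold halfCourant
  rw [fderiv_clm_apply hη hX]
  simp [mul_add]

theorem halfCourant_add {X : E → E} {η η' : E → E →L[ℝ] ℝ} {u : E} (hX : DifferentiableAt ℝ X u)
    (hη : DifferentiableAt ℝ η u) (hη' : DifferentiableAt ℝ η' u) (a b : ℝ) :
    halfCourant X (fun w => a • η w + b • η' w) u =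
      a • halfCourant X η u + b • halfCourant X η' u := by
  ext Z
  have h1 : HasFDerivAt (fun w => a • η w + b • η' w) (a • fderiv ℝ η u + b • fderiv ℝ η' u) u :=
    (hη.hasFDerivAt.const_smul a).add (hη'.hasFDerivAt.const_smul b)
  simp only [add_apply, smul_apply, smul_eq_mul]
  rw [halfCourant_apply hX h1.differentiableAt, halfCourant_apply hX hη, halfCourant_apply hX hη',
    h1.fderiv]
  simp only [add_apply, smul_apply, smul_eq_mul]
  ring

theorem hasFDerivAt_flat_comp {τ : E → E [⋀^Fin 2]→L[ℝ] ℝ} {u : E}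
    (hτ : DifferentiableAt ℝ τ u) :
    HasFDerivAt (fun w => flat (τ w)) ((flatL (E := E)) ∘L fderiv ℝ τ u) u := by
  have h := HasFDerivAt.comp (G := E →L[ℝ] (E →L[ℝ] ℝ)) (g := fun τ => flat τ)
    (g' := flatL (E := E)) u (hasFDerivAt_flat (τ u)) hτ.hasFDerivAt
  exact h

theorem differentiableAt_flat {X : E → E} {τ : E → E [⋀^Fin 2]→L[ℝ] ℝ} {u : E}
    (hX : DifferentiableAt ℝ X u) (hτ : DifferentiableAt ℝ τ u) :
    DifferentiableAt ℝ (fun w => flat (τ w) (X w)) u :=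
  (hasFDerivAt_flat_comp hτ).differentiableAt.clm_apply hX

theorem fderiv_flat {X : E → E} {τ : E → E [⋀^Fin 2]→L[ℝ] ℝ} {u : E}
    (hX : DifferentiableAt ℝ X u) (hτ : DifferentiableAt ℝ τ u) (Z : E) :
    fderiv ℝ (fun w => flat (τ w) (X w)) u Z =
      flat (fderiv ℝ τ u Z) (X u) + flat (τ u) (fderiv ℝ X u Z) := by
  have h := hasFDerivAt_flat_comp hτ
  rw [fderiv_clm_apply h.differentiableAt hX, h.fderiv]
  ext Y
  simp [add_comm]

/-- The graph of a closed 2-form is closed under the Courant bracket. -/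
theorem halfCourant_closed {X Y : E → E} {τ : E → E [⋀^Fin 2]→L[ℝ] ℝ} {u : E}
    (hX : DifferentiableAt ℝ X u) (hY : DifferentiableAt ℝ Y u) (hτ : DifferentiableAt ℝ τ u)
    (hd : extDeriv τ u = 0) :
    halfCourant X (fun w => flat (τ w) (Y w)) u - halfCourant Y (fun w => flat (τ w) (X w)) u =
      flat (τ u) (VectorField.lieBracket ℝ X Y u) := by
  ext Z
  -- The derivatives of `τ` add up to `dτ(X, Y, Z) = 0`, those of `X` and `Y` along `Z` cancel by
  -- antisymmetry thanks to the factor `1/2`, and `τ([X, Y], Z)` remains.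
  have h := extDeriv_two_apply τ u (X u) (Y u) Z
  rw [hd] at h
  change 0 = _ at h
  rw [sub_apply, halfCourant_apply hX (differentiableAt_flat hY hτ),
    halfCourant_apply hY (differentiableAt_flat hX hτ), fderiv_flat hY hτ, fderiv_flat hY hτ,
    fderiv_flat hX hτ, fderiv_flat hX hτ, VectorField.lieBracket]
  simp only [add_apply, map_sub, sub_apply]
  rw [flat_swap _ (Y u) (X u), flat_swap _ (fderiv ℝ Y u Z) (X u),
    flat_swap _ (fderiv ℝ X u Z) (Y u)]
  linarith

end FlatCourant

/-! ### Sections of `T ⊕ T*` in charts -/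

section Sections

variable {E : Type*} [NormedAddCommGroup E] [NormedSpace ℝ E] {H : Type*} [TopologicalSpace H]
  {I : ModelWithCorners ℝ E H} {P : Type*} [TopologicalSpace P] [ChartedSpace H P]

/-- The expression of a vector field in the preferred chart at `x₀`. -/
def vfChart (X : (x : P) → TangentSpace I x) (x₀ : P) (y : E) : E :=
  cderiv I (extChartAt I x₀) ((extChartAt I x₀).symm y) (X ((extChartAt I x₀).symm y))

/-- The expression of a field of covectors in the preferred chart at `x₀`. -/
def covChart (ξ : CovectorField I P) (x₀ : P) (y : E) : E →L[ℝ] ℝ :=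
  let α : E →L[ℝ] ℝ := ξ ((extChartAt I x₀).symm y)
  α ∘L tderiv I (extChartAt I x₀).symm y

theorem vfChart_apply (X : (x : P) → TangentSpace I x) {x₀ x : P}
    (hx : x ∈ (extChartAt I x₀).source) :
    vfChart X x₀ (extChartAt I x₀ x) = cderiv I (extChartAt I x₀) x (X x) := by
  let X' : P → E := X
  change cderiv I _ _ (X' _) = cderiv I _ _ (X' _)
  rw [(extChartAt I x₀).left_inv hx]

variable [I.Boundaryless]

theorem toForm_inChart (ξ : CovectorField I P) (x₀ : P) (y : E) :
    ξ.toForm.inChart x₀ y =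
      ContinuousAlternatingMap.ofSubsingleton ℝ E ℝ (0 : Fin 1) (covChart ξ x₀ y) := by
  rw [inChart_eq_pull]
  rfl

theorem toForm_smoothOn_iff (ξ : CovectorField I P) (U : Set P) :
    ξ.toForm.SmoothOn U ↔ ∀ x₀ : P, ContDiffOn ℝ ∞ (covChart ξ x₀)
      ((extChartAt I x₀).target ∩ (extChartAt I x₀).symm ⁻¹' U) := by
  refine forall_congr' fun x₀ => ?_
  let e := (ContinuousAlternatingMap.ofSubsingletonLIE (𝕜 := ℝ) (E := E) (F := ℝ)
      (0 : Fin 1)).toContinuousLinearEquiv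
  have h : ξ.toForm.inChart x₀ = e ∘ covChart ξ x₀ := funext fun y => toForm_inChart ξ x₀ y
  rw [h, e.comp_contDiffOn_iff]

variable [IsManifold I ∞ P]

theorem tderiv_cderiv_symm {x₀ : P} {y : E} (hy : y ∈ (extChartAt I x₀).target) (v : E) :
    tderiv I (extChartAt I x₀).symm y
      (cderiv I (extChartAt I x₀) ((extChartAt I x₀).symm y) v) = v := by
  have h := tderiv_cderiv_chart ((extChartAt I x₀).map_target hy)
  rw [(extChartAt I x₀).right_inv hy] at h
  exact congrArg (fun l : E →L[ℝ] E => l v) h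

theorem cderiv_tderiv_symm {x₀ : P} {y : E} (hy : y ∈ (extChartAt I x₀).target) (v : E) :
    cderiv I (extChartAt I x₀) ((extChartAt I x₀).symm y)
      (tderiv I (extChartAt I x₀).symm y v) = v :=
  congrArg (fun l : E →L[ℝ] E => l v) (cderiv_tderiv_chart hy)

/-- The trivialization of the tangent bundle at `x₀` is fibrewise the derivative of the chart at
`x₀`. -/
theorem contMDiffOn_vectorField_iff (X : (x : P) → TangentSpace I x) {U : Set P} (hU : IsOpen U) :
    ContMDiffOn I I.tangent ∞ (fun x => (⟨x, X x⟩ : TangentBundle I P)) U ↔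
      ∀ x₀ : P, ContDiffOn ℝ ∞ (vfChart X x₀)
        ((extChartAt I x₀).target ∩ (extChartAt I x₀).symm ⁻¹' U) := by
  have key : ∀ x₀ x : P, x ∈ (extChartAt I x₀).source →
      (ContMDiffAt I I.tangent ∞ (fun x => (⟨x, X x⟩ : TangentBundle I P)) x ↔
        ContMDiffAt I 𝓘(ℝ, E) ∞ (fun w => cderiv I (extChartAt I x₀) w (X w)) x) := by
    intro x₀ x hx
    have hx' : x ∈ (trivializationAt E (TangentSpace I) x₀).baseSet := by
      rw [TangentBundle.trivializationAt_baseSet, ← extChartAt_source (I := I)]; exact hx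
    have h := Bundle.Trivialization.contMDiffAt_section_iff (IB := I) (n := ∞) (s := X)
      (trivializationAt E (TangentSpace I) x₀) hx'
    refine h.trans (Filter.EventuallyEq.contMDiffAt_iff ?_)
    filter_upwards [(isOpen_extChartAt_source (I := I) x₀).mem_nhds hx] with w hw
    have hw' : w ∈ (chartAt H x₀).source := by rwa [← extChartAt_source (I := I)]
    have hb : w ∈ (trivializationAt E (TangentSpace I) x₀).baseSet := by
      rw [TangentBundle.trivializationAt_baseSet]; exact hw'
    have h1 : Bundle.Trivialization.continuousLinearMapAt ℝ
        (trivializationAt E (TangentSpace I) x₀) w (X w) =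
        cderiv I (extChartAt I x₀) w (X w) := by
      rw [TangentBundle.continuousLinearMapAt_trivializationAt hw']
      rfl
    rw [← h1, Bundle.Trivialization.continuousLinearMapAt_apply,
      Bundle.Trivialization.coe_linearMapAt_of_mem _ hb]
  constructor
  · intro h x₀ y hy
    refine ContDiffAt.contDiffWithinAt ?_
    have h1 := (key x₀ _ ((extChartAt I x₀).map_target hy.1)).1 (h.contMDiffAt (hU.mem_nhds hy.2))
    rw [← contMDiffAt_iff_contDiffAt]
    exact ContMDiffAt.comp y h1 (contMDiffAt_chart_symm hy.1)
  · intro h x hx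
    refine ContMDiffAt.contMDiffWithinAt ?_
    have hxs := mem_extChartAt_source (I := I) x
    rw [key x x hxs]
    have h1 : ContDiffAt ℝ ∞ (vfChart X x) (extChartAt I x x) :=
      (h x).contDiffAt ((isOpen_chart_preimage x hU).mem_nhds
        ⟨mem_extChartAt_target x, by simpa using hx⟩)
    refine ContMDiffAt.congr_of_eventuallyEq
      (ContMDiffAt.comp x h1.contMDiffAt (contMDiffAt_chart hxs)) ?_
    filter_upwards [(isOpen_extChartAt_source (I := I) x).mem_nhds hxs] with w hw
    exact (vfChart_apply X hw).symm

theorem genSection_smoothOn_iff (s : GenSection I P) {U : Set P} (hU : IsOpen U) :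
    s.SmoothOn U ↔ ∀ x₀ : P,
      ContDiffOn ℝ ∞ (vfChart (fun x => (s x).1) x₀)
        ((extChartAt I x₀).target ∩ (extChartAt I x₀).symm ⁻¹' U) ∧
      ContDiffOn ℝ ∞ (covChart (fun x => (s x).2) x₀)
        ((extChartAt I x₀).target ∩ (extChartAt I x₀).symm ⁻¹' U) := by
  unfold GenSection.SmoothOn
  rw [contMDiffOn_vectorField_iff _ hU, toForm_smoothOn_iff, forall_and]

theorem flat_inChart (σ : DiffForm I P 2) {x₀ : P} {y : E} (X Y : E)
    (hy : y ∈ (extChartAt I x₀).target) :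
    flat (σ.inChart x₀ y) (cderiv I (extChartAt I x₀) ((extChartAt I x₀).symm y) X) Y =
      flat (E := E) (σ ((extChartAt I x₀).symm y)) X (tderiv I (extChartAt I x₀).symm y Y) := by
  rw [inChart_eq_pull, flat_pull, tderiv_cderiv_symm hy]

theorem covChart_flat (σ : DiffForm I P 2) (X : (x : P) → TangentSpace I x) {x₀ : P} {y : E}
    (hy : y ∈ (extChartAt I x₀).target) :
    covChart (I := I) (fun x => flat (E := E) (σ x) (X x)) x₀ y =
      flat (σ.inChart x₀ y) (vfChart X x₀ y) := by
  ext Z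
  exact (flat_inChart σ _ _ hy).symm

theorem flat_inChart_isInvertible [FiniteDimensional ℝ E] {Ω : DiffForm I P 2} {x₀ : P} {y : E}
    (hy : y ∈ (extChartAt I x₀).target)
    (h : ∀ X : E, (∀ Y : E, flat (E := E) (Ω ((extChartAt I x₀).symm y)) X Y = 0) → X = 0) :
    (flat (Ω.inChart x₀ y)).IsInvertible := by
  refine flat_isInvertible fun X hX => ?_
  have h1 : tderiv I (extChartAt I x₀).symm y X = 0 := by
    refine h _ fun Y => ?_
    have h2 := hX (cderiv I (extChartAt I x₀) ((extChartAt I x₀).symm y) Y)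
    rw [← flat_apply] at h2
    rwa [inChart_eq_pull, flat_pull, tderiv_cderiv_symm hy] at h2
  rw [← cderiv_tderiv_symm hy X, h1, map_zero]

end Sections

/-! ### The Courant bracket in charts -/

section Bracket

variable {E : Type*} [NormedAddCommGroup E] [NormedSpace ℝ E] {H : Type*} [TopologicalSpace H]
  {I : ModelWithCorners ℝ E H} {P : Type*} [TopologicalSpace P] [ChartedSpace H P]
  [IsManifold I ∞ P]

theorem dFun_eq {f : P → ℝ} {g : E → ℝ} {x : P} (h : f =ᶠ[𝓝 x] g ∘ extChartAt I x)
    (hg : DifferentiableAt ℝ g (extChartAt I x x)) :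
    (dFun I f x : E →L[ℝ] ℝ) = fderiv ℝ g (extChartAt I x x) ∘L cderiv I (extChartAt I x) x :=
  (cderiv_congr h).trans (cderiv_comp hg (mdifferentiableAt_chart (mem_extChartAt_source x)))

variable [I.Boundaryless]

theorem covChart_vfChart (η : CovectorField I P) (X : (x : P) → TangentSpace I x) {x₀ x : P}
    (hx : x ∈ (extChartAt I x₀).source) :
    covChart η x₀ (extChartAt I x₀ x) (vfChart X x₀ (extChartAt I x₀ x)) = η x (X x) := by
  have h := tderiv_cderiv_symm ((extChartAt I x₀).map_source hx)
    (X ((extChartAt I x₀).symm (extChartAt I x₀ x)))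
  let X' : P → E := X
  let η' : P → E →L[ℝ] ℝ := η
  change η' ((extChartAt I x₀).symm (extChartAt I x₀ x)) _ = η' x (X' x)
  have h2 : covChart η x₀ (extChartAt I x₀ x) (vfChart X x₀ (extChartAt I x₀ x)) =
      η' ((extChartAt I x₀).symm (extChartAt I x₀ x))
        (X' ((extChartAt I x₀).symm (extChartAt I x₀ x))) :=
    congrArg (η' ((extChartAt I x₀).symm (extChartAt I x₀ x))) h
  refine h2.trans ?_
  rw [(extChartAt I x₀).left_inv hx]

theorem pairing_eventuallyEq (η : CovectorField I P) (X : (x : P) → TangentSpace I x) (x : P) :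
    (fun y => η y (X y)) =ᶠ[𝓝 x] (fun w => covChart η x w (vfChart X x w)) ∘ extChartAt I x := by
  filter_upwards [(isOpen_extChartAt_source (I := I) x).mem_nhds (mem_extChartAt_source x)]
    with y hy
  exact (covChart_vfChart η X hy).symm

theorem covChart_comp_cderiv (η : CovectorField I P) {x₀ x : P}
    (hx : x ∈ (extChartAt I x₀).source) :
    covChart η x₀ (extChartAt I x₀ x) ∘L cderiv I (extChartAt I x₀) x = η x := by
  ext v
  exact (congrArg (covChart η x₀ (extChartAt I x₀ x)) (vfChart_apply (fun _ => v) hx)).symm.trans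
    (covChart_vfChart η (fun _ => v) hx)

/-- In Cartan's formula the term `(D_Z η)(X)` occurs in `ι_X dη` and in `d(η(X))` with opposite
signs. -/
theorem lieDerivative_eq (X : (x : P) → TangentSpace I x) (η : CovectorField I P) {x : P}
    (hX : DifferentiableAt ℝ (vfChart X x) (extChartAt I x x))
    (hη : DifferentiableAt ℝ (covChart η x) (extChartAt I x x)) :
    (lieDerivative X η x : E →L[ℝ] ℝ) =
      (fderiv ℝ (covChart η x) (extChartAt I x x) (vfChart X x (extChartAt I x x)) +
        covChart η x (extChartAt I x x) ∘L fderiv ℝ (vfChart X x) (extChartAt I x x)) ∘L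
        cderiv I (extChartAt I x) x := by
  have hx := mem_extChartAt_source (I := I) x
  refine ContinuousLinearMap.ext fun (Z : E) => ?_
  have h1 : (dFun I (fun y => η y (X y)) x : E →L[ℝ] ℝ) = _ :=
    dFun_eq (pairing_eventuallyEq η X x) (hη.clm_apply hX)
  rw [fderiv_clm_apply hη hX] at h1
  have h2 : flat (E := E) (η.toForm.d x) (X x) Z =
      fderiv ℝ (covChart η x) (extChartAt I x x) (cderiv I (extChartAt I x) x (X x))
        (cderiv I (extChartAt I x) x Z) -
      fderiv ℝ (covChart η x) (extChartAt I x x) (cderiv I (extChartAt I x) x Z)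
        (cderiv I (extChartAt I x) x (X x)) := by
    rw [d_eq, ← extDeriv_one_apply hη]
    have h3 : η.toForm.inChart x = fun w =>
        ContinuousAlternatingMap.ofSubsingleton ℝ E ℝ (0 : Fin 1) (covChart η x w) :=
      funext fun y => toForm_inChart η x y
    rw [h3]
    exact flat_compContinuousLinearMap _ _ _ _
  have h4 : (lieDerivative X η x : E →L[ℝ] ℝ) Z = flat (E := E) (η.toForm.d x) (X x) Z +
      (dFun I (fun y => η y (X y)) x : E →L[ℝ] ℝ) Z := rfl
  have h5 : (dFun I (fun y => η y (X y)) x : E →L[ℝ] ℝ) Z =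
      covChart η x (extChartAt I x x) (fderiv ℝ (vfChart X x) (extChartAt I x x)
        (cderiv I (extChartAt I x) x Z)) +
      fderiv ℝ (covChart η x) (extChartAt I x x) (cderiv I (extChartAt I x) x Z)
        (vfChart X x (extChartAt I x x)) := congrArg (fun l : E →L[ℝ] ℝ => l Z) h1
  change _ = fderiv ℝ (covChart η x) (extChartAt I x x) (vfChart X x (extChartAt I x x))
      (cderiv I (extChartAt I x) x Z) +
    covChart η x (extChartAt I x x) (fderiv ℝ (vfChart X x) (extChartAt I x x)
      (cderiv I (extChartAt I x) x Z))
  rw [← vfChart_apply X hx] at h2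
  rw [h4, h2, h5]
  ring

/-- The correction `-(1/2) d(ι_X η - ι_Y ξ)` is shared between the two Lie derivatives, so the
1-form part becomes a difference of two `halfCourant` terms. -/
theorem courant_snd (s t : GenSection I P) {x : P}
    (hX : DifferentiableAt ℝ (vfChart (fun y => (s y).1) x) (extChartAt I x x))
    (hξ : DifferentiableAt ℝ (covChart (fun y => (s y).2) x) (extChartAt I x x))
    (hY : DifferentiableAt ℝ (vfChart (fun y => (t y).1) x) (extChartAt I x x))
    (hη : DifferentiableAt ℝ (covChart (fun y => (t y).2) x) (extChartAt I x x)) :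
    ((courant s t x).2 : E →L[ℝ] ℝ) =
      (halfCourant (vfChart (fun y => (s y).1) x) (covChart (fun y => (t y).2) x)
          (extChartAt I x x) -
        halfCourant (vfChart (fun y => (t y).1) x) (covChart (fun y => (s y).2) x)
          (extChartAt I x x)) ∘L cderiv I (extChartAt I x) x := by
  have h1 : (fun y => (t y).2 (s y).1 - (s y).2 (t y).1) =ᶠ[𝓝 x]
      (fun w => covChart (fun y => (t y).2) x w (vfChart (fun y => (s y).1) x w) -
        covChart (fun y => (s y).2) x w (vfChart (fun y => (t y).1) x w)) ∘ extChartAt I x := by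
    filter_upwards [pairing_eventuallyEq (fun y => (t y).2) (fun y => (s y).1) x,
      pairing_eventuallyEq (fun y => (s y).2) (fun y => (t y).1) x] with y hy1 hy2
    exact congrArg₂ (· - ·) hy1 hy2
  have hg1 := hη.clm_apply hX
  have hg2 := hξ.clm_apply hY
  have h2 := dFun_eq h1 (hg1.sub hg2)
  rw [fderiv_fun_sub hg1 hg2] at h2
  have h3 := lieDerivative_eq _ _ hX hη
  have h4 := lieDerivative_eq _ _ hY hξ
  have h5 : ((courant s t x).2 : E →L[ℝ] ℝ) =
      (lieDerivative (fun y => (s y).1) (fun y => (t y).2) x : E →L[ℝ] ℝ) -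
      (lieDerivative (fun y => (t y).1) (fun y => (s y).2) x : E →L[ℝ] ℝ) -
      (1 / 2 : ℝ) • (dFun I (fun y => (t y).2 (s y).1 - (s y).2 (t y).1) x : E →L[ℝ] ℝ) := rfl
  have halg : ∀ (a b c d : E →L[ℝ] ℝ) (D : E →L[ℝ] E),
      a ∘L D - b ∘L D - (1 / 2 : ℝ) • ((c - d) ∘L D) =
        ((a - (1 / 2 : ℝ) • c) - (b - (1 / 2 : ℝ) • d)) ∘L D := by
    intro a b c d D
    ext Z
    simp only [ContinuousLinearMap.comp_apply, sub_apply, smul_apply, smul_eq_mul]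
    ring
  refine h5.trans (Eq.trans ?_ (halg _ _ _ _ _))
  exact congrArg₂ (· - ·) (congrArg₂ (· - ·) h3 h4) (congrArg (fun l => (1 / 2 : ℝ) • l) h2)

/-- The bracket of vector fields on a manifold is by definition that of their pullbacks to the
preferred chart, which agree with `vfChart` near the point. -/
theorem courant_fst [CompleteSpace E] (s t : GenSection I P) (x : P) :
    cderiv I (extChartAt I x) x (courant s t x).1 =
      VectorField.lieBracket ℝ (vfChart (fun y => (s y).1) x) (vfChart (fun y => (t y).1) x)
        (extChartAt I x x) := by
  have hx := mem_extChartAt_source (I := I) x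
  have key : ∀ X : (x : P) → TangentSpace I x,
      (VectorField.mpullbackWithin 𝓘(ℝ, E) I (extChartAt I x).symm X (Set.range I)) =ᶠ[𝓝
        (extChartAt I x x)] vfChart X x := by
    intro X
    filter_upwards [(isOpen_extChartAt_target (I := I) x).mem_nhds (mem_extChartAt_target x)]
      with y hy
    have h : (tderiv I (extChartAt I x).symm y).inverse =
        cderiv I (extChartAt I x) ((extChartAt I x).symm y) :=
      ContinuousLinearMap.inverse_eq
        (ContinuousLinearMap.ext fun v => tderiv_cderiv_symm hy v) (cderiv_tderiv_chart hy)
    unfold vfChart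
    rw [← h]
    simp only [VectorField.mpullbackWithin_apply, I.range_eq_univ, mfderivWithin_univ]
    rfl
  have h1 : (courant s t x).1 = (cderiv I (extChartAt I x) x).inverse
      (VectorField.lieBracket ℝ (vfChart (fun y => (s y).1) x) (vfChart (fun y => (t y).1) x)
        (extChartAt I x x)) := by
    have h2 := VectorField.mlieBracketWithin_apply (I := I) (s := Set.univ) (x₀ := x)
      (V := fun y => (s y).1) (W := fun y => (t y).1)
    rw [VectorField.mlieBracketWithin_univ, Set.preimage_univ, Set.univ_inter] at h2
    refine h2.trans (congrArg (cderiv I (extChartAt I x) x).inverse ?_)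
    have h3 := Filter.EventuallyEq.lieBracket_vectorField_eq (𝕜 := ℝ) (key fun y => (s y).1)
      (key fun y => (t y).1)
    refine Eq.trans ?_ h3
    conv_lhs => rw [I.range_eq_univ]
    rw [I.range_eq_univ]
    exact congrFun VectorField.lieBracketWithin_univ _
  rw [h1]
  have h3 : (cderiv I (extChartAt I x) x).IsInvertible :=
    isInvertible_mfderiv_extChartAt hx
  exact h3.self_apply_inverse _

end Bracket

/-! ### Hitchin pairs give integrable generalized complex structures -/

section Hitchin

variable {E : Type*} [NormedAddCommGroup E] [NormedSpace ℝ E]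

/-- If `ξ, ξ'` and `η, η'` are the 1-form parts of two complex sections of the graph of a complex
closed 2-form `-σ + i ε Ω`, so are those of their Courant bracket. -/
theorem halfCourant_graph {σ Ω : E → E [⋀^Fin 2]→L[ℝ] ℝ} {u : E} {ε : ℝ}
    (hσ : DifferentiableAt ℝ σ u) (hΩ : DifferentiableAt ℝ Ω u)
    (dσ : extDeriv σ u = 0) (dΩ : extDeriv Ω u = 0)
    {X X' Y Y' : E → E} {ξ ξ' η η' : E → E →L[ℝ] ℝ}
    (hX : DifferentiableAt ℝ X u) (hX' : DifferentiableAt ℝ X' u)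
    (hY : DifferentiableAt ℝ Y u) (hY' : DifferentiableAt ℝ Y' u)
    (hξ : ξ =ᶠ[𝓝 u] fun w => -(ε • flat (Ω w) (X' w)) - flat (σ w) (X w))
    (hξ' : ξ' =ᶠ[𝓝 u] fun w => ε • flat (Ω w) (X w) - flat (σ w) (X' w))
    (hη : η =ᶠ[𝓝 u] fun w => -(ε • flat (Ω w) (Y' w)) - flat (σ w) (Y w))
    (hη' : η' =ᶠ[𝓝 u] fun w => ε • flat (Ω w) (Y w) - flat (σ w) (Y' w)) :
    ((halfCourant X η u - halfCourant Y ξ u) - (halfCourant X' η' u - halfCourant Y' ξ' u) =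
      -(ε • flat (Ω u) (VectorField.lieBracket ℝ X Y' u + VectorField.lieBracket ℝ X' Y u)) -
        flat (σ u) (VectorField.lieBracket ℝ X Y u - VectorField.lieBracket ℝ X' Y' u)) ∧
    ((halfCourant X η' u - halfCourant Y' ξ u) + (halfCourant X' η u - halfCourant Y ξ' u) =
      ε • flat (Ω u) (VectorField.lieBracket ℝ X Y u - VectorField.lieBracket ℝ X' Y' u) -
        flat (σ u) (VectorField.lieBracket ℝ X Y' u + VectorField.lieBracket ℝ X' Y u)) := by
  have key : ∀ (c : ℝ) {Z A B : E → E} {ζ : E → E →L[ℝ] ℝ}, DifferentiableAt ℝ Z u →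
      DifferentiableAt ℝ A u → DifferentiableAt ℝ B u →
      (ζ =ᶠ[𝓝 u] fun w => c • flat (Ω w) (A w) + (-1 : ℝ) • flat (σ w) (B w)) →
      halfCourant Z ζ u = c • halfCourant Z (fun w => flat (Ω w) (A w)) u
        + (-1 : ℝ) • halfCourant Z (fun w => flat (σ w) (B w)) u := by
    intro c Z A B ζ hZ hA hB h
    rw [halfCourant_congr h, halfCourant_add hZ (differentiableAt_flat hA hΩ)
      (differentiableAt_flat hB hσ)]
  have e1 : ∀ {A B : E → E} {ζ : E → E →L[ℝ] ℝ},
      (ζ =ᶠ[𝓝 u] fun w => -(ε • flat (Ω w) (A w)) - flat (σ w) (B w)) →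
      (ζ =ᶠ[𝓝 u] fun w => (-ε) • flat (Ω w) (A w) + (-1 : ℝ) • flat (σ w) (B w)) := by
    intro A B ζ h
    refine h.trans (Filter.Eventually.of_forall fun w => ?_)
    dsimp only
    module
  have e2 : ∀ {A B : E → E} {ζ : E → E →L[ℝ] ℝ},
      (ζ =ᶠ[𝓝 u] fun w => ε • flat (Ω w) (A w) - flat (σ w) (B w)) →
      (ζ =ᶠ[𝓝 u] fun w => ε • flat (Ω w) (A w) + (-1 : ℝ) • flat (σ w) (B w)) := by
    intro A B ζ h
    refine h.trans (Filter.Eventually.of_forall fun w => ?_)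
    dsimp only
    module
  -- Expanding the complex bracket bilinearly leaves one closed-graph identity for each of `σ`, `Ω`
  -- and each of the four pairs of real fields; the real and the imaginary part use four of them
  -- each.
  have s1 := halfCourant_closed hX hY hσ dσ
  have s2 := halfCourant_closed hX' hY' hσ dσ
  have s3 := halfCourant_closed hX hY' hσ dσ
  have s4 := halfCourant_closed hX' hY hσ dσ
  have o1 := halfCourant_closed hX hY hΩ dΩ
  have o2 := halfCourant_closed hX' hY' hΩ dΩ
  have o3 := halfCourant_closed hX hY' hΩ dΩ
  have o4 := halfCourant_closed hX' hY hΩ dΩ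
  constructor
  · rw [key _ hX hY' hY (e1 hη), key _ hY hX' hX (e1 hξ), key _ hX' hY hY' (e2 hη'),
      key _ hY' hX hX' (e2 hξ'), map_add, map_sub, ← s1, ← s2, ← o3, ← o4]
    module
  · rw [key _ hX hY hY' (e2 hη'), key _ hY' hX' hX (e1 hξ), key _ hX' hY' hY (e1 hη),
      key _ hY hX hX' (e2 hξ'), map_add, map_sub, ← s3, ← s4, ← o1, ← o2]
    module

variable {H : Type*} [TopologicalSpace H]
  {I : ModelWithCorners ℝ E H} {P : Type*} [TopologicalSpace P] [ChartedSpace H P]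
  [FiniteDimensional ℝ E]

theorem IsSymplecticOn.flat_isInvertible {Ω : DiffForm I P 2} {W : Set P}
    (hΩ : IsSymplecticOn I Ω W) {x : P} (hx : x ∈ W) : (flat (E := E) (Ω x)).IsInvertible :=
  SMAE.flat_isInvertible (E := E) (hΩ.nondegenerate x hx)

variable [IsManifold I ∞ P] [I.Boundaryless]

theorem IsSymplecticOn.flat_inChart_isInvertible {Ω : DiffForm I P 2} {W : Set P}
    (hΩ : IsSymplecticOn I Ω W) {x₀ : P} {y : E} (hy : y ∈ (extChartAt I x₀).target)
    (hyW : (extChartAt I x₀).symm y ∈ W) : (flat (Ω.inChart x₀ y)).IsInvertible := by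
  refine SMAE.flat_inChart_isInvertible hy fun X hX => hΩ.nondegenerate _ hyW X fun Y => ?_
  exact (flat_apply (E := E) _ X Y).symm.trans (hX Y)

/-- The vector `N` is characterized by `ι_N Ω = ι_X σ + ξ`, an equation between covectors that
charts respect; so the construction commutes with charts. -/
theorem pairStructure_inChart (σ : DiffForm I P 2) {Ω : DiffForm I P 2} {W : Set P}
    (hΩ : IsSymplecticOn I Ω W) (s : GenSection I P) {x₀ : P} {y : E}
    (hy : y ∈ (extChartAt I x₀).target) (hyW : (extChartAt I x₀).symm y ∈ W) :
    (vfChart (fun x => (pairStructure σ Ω x (s x)).1) x₀ y,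
      covChart (fun x => (pairStructure σ Ω x (s x)).2) x₀ y) =
      pairMatrix (σ.inChart x₀ y) (Ω.inChart x₀ y)
        (vfChart (fun x => (s x).1) x₀ y, covChart (fun x => (s x).2) x₀ y) := by
  have hinv := hΩ.flat_isInvertible hyW
  have hinv' := hΩ.flat_inChart_isInvertible hy hyW
  set p := (extChartAt I x₀).symm y with hp
  let v : E × (E →L[ℝ] ℝ) := s p
  let N : E := (pairStructure σ Ω p (s p)).1
  have hJ : (pairStructure σ Ω p (s p) : E × (E →L[ℝ] ℝ)) =
    ((flat (E := E) (Ω p)).inverse (flat (E := E) (σ p) v.1 + v.2), -flat (E := E) (Ω p) v.1 -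
      flat (E := E) (σ p) ((flat (E := E) (Ω p)).inverse (flat (E := E) (σ p) v.1 + v.2))) :=
    pairMatrix_apply (E := E) (σ p) hinv v
  have hN : N = (flat (E := E) (Ω p)).inverse (flat (E := E) (σ p) v.1 + v.2) :=
    congrArg Prod.fst hJ
  have hN2 : flat (E := E) (Ω p) N = flat (E := E) (σ p) v.1 + v.2 := by
    rw [hN]; exact flat_inverse_apply hinv _
  have h2 : ((pairStructure σ Ω p (s p)).2 : E →L[ℝ] ℝ) =
      -flat (E := E) (Ω p) v.1 - flat (E := E) (σ p) N := by
    rw [hN]; exact congrArg Prod.snd hJ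
  have hvf : vfChart (fun x => (pairStructure σ Ω x (s x)).1) x₀ y =
      cderiv I (extChartAt I x₀) p N := rfl
  have key : flat (Ω.inChart x₀ y) (cderiv I (extChartAt I x₀) p N) =
      flat (σ.inChart x₀ y) (vfChart (fun x => (s x).1) x₀ y) +
        covChart (fun x => (s x).2) x₀ y := by
    ext Z
    rw [add_apply, flat_inChart Ω N Z hy]
    unfold vfChart
    rw [flat_inChart σ (s p).1 Z hy]
    exact congrArg (fun l : E →L[ℝ] ℝ => l (tderiv I (extChartAt I x₀).symm y Z)) hN2
  have hN3 : vfChart (fun x => (pairStructure σ Ω x (s x)).1) x₀ y =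
      (flat (Ω.inChart x₀ y)).inverse (flat (σ.inChart x₀ y) (vfChart (fun x => (s x).1) x₀ y) +
        covChart (fun x => (s x).2) x₀ y) := by
    rw [← key, inverse_flat_apply hinv', hvf]
  rw [pairMatrix_apply _ hinv']
  refine Prod.ext hN3 ?_
  simp only
  rw [← hN3, hvf]
  ext Z
  rw [sub_apply, neg_apply, flat_inChart σ N Z hy]
  unfold vfChart
  rw [flat_inChart Ω (s p).1 Z hy]
  exact congrArg (fun l : E →L[ℝ] ℝ => l (tderiv I (extChartAt I x₀).symm y Z)) h2

theorem pairStructure_smoothOn {σ Ω : DiffForm I P 2} {W : Set P} (hΩ : IsSymplecticOn I Ω W)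
    (hσ : σ.SmoothOn W) {U : Set P} (hU : IsOpen U) (hUW : U ⊆ W) {s : GenSection I P}
    (hs : s.SmoothOn U) : GenSection.SmoothOn (fun x => pairStructure σ Ω x (s x)) U := by
  rw [genSection_smoothOn_iff _ hU] at hs ⊢
  intro x₀
  obtain ⟨hX, hξ⟩ := hs x₀
  set S := (extChartAt I x₀).target ∩ (extChartAt I x₀).symm ⁻¹' U with hS
  have hflat : ∀ {τ : DiffForm I P 2}, τ.SmoothOn W →
      ContDiffOn ℝ ∞ (fun y => flat (τ.inChart x₀ y)) S := fun {τ} hτ =>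
    contDiff_flat.comp_contDiffOn (hτ.mono hUW x₀)
  -- Inversion of continuous linear maps is smooth at invertible ones, and nondegeneracy gives
  -- invertibility on `S`.
  have hinv : ContDiffOn ℝ ∞ (fun y => (flat (Ω.inChart x₀ y)).inverse) S := by
    intro y hy
    have h1 := hΩ.flat_inChart_isInvertible hy.1 (hUW hy.2)
    exact ContDiffAt.comp_contDiffWithinAt y h1.contDiffAt_map_inverse (hflat hΩ.smooth y hy)
  have hN : ContDiffOn ℝ ∞ (fun y => (flat (Ω.inChart x₀ y)).inverse
      (flat (σ.inChart x₀ y) (vfChart (fun x => (s x).1) x₀ y) +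
        covChart (fun x => (s x).2) x₀ y)) S :=
    hinv.clm_apply (((hflat hσ).clm_apply hX).add hξ)
  have hη := ((hflat hΩ.smooth).clm_apply hX).neg.sub ((hflat hσ).clm_apply hN)
  have heq : ∀ y ∈ S, _ := fun y hy =>
    (pairStructure_inChart σ hΩ s hy.1 (hUW hy.2)).trans
      (pairMatrix_apply _ (hΩ.flat_inChart_isInvertible hy.1 (hUW hy.2)) _)
  exact ⟨hN.congr fun y hy => congrArg Prod.fst (heq y hy),
    hη.congr fun y hy => congrArg Prod.snd (heq y hy)⟩

/-- The bundle map of a Hitchin pair is an integrable generalized complex structure. -/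
theorem IsHitchinPairOn.isGenComplexOn {σ Ω : DiffForm I P 2} {W : Set P}
    (h : IsHitchinPairOn I σ Ω W) (hW : IsOpen W) : IsGenComplexOn I (pairStructure σ Ω) W where
  smooth U hU hUW s hs := pairStructure_smoothOn h.symplectic h.smooth hU hUW hs
  sq x hx v := pairMatrix_pairMatrix (E := E) (σ x) (h.symplectic.flat_isInvertible hx) v
  skew x hx u v := by
    have := pairMatrix_skew (E := E) (σ x) (h.symplectic.flat_isInvertible hx) u v
    unfold genInner
    rw [← mul_neg]
    exact congrArg (fun r : ℝ => (1 / 2) * r) this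
  integrable ε hε U hU hUW s t s' t' hs ht hs' ht' he he' := by
    intro x hx
    have hε2 : ε * ε = 1 := by rcases hε with rfl | rfl <;> norm_num
    have hxt := mem_extChartAt_target (I := I) x
    have hxs := mem_extChartAt_source (I := I) x
    have hxU : (extChartAt I x).symm (extChartAt I x x) ∈ U := by simpa using hx
    have hmem := (isOpen_chart_preimage x hU).mem_nhds ⟨hxt, hxU⟩
    have hd : ∀ {r : GenSection I P}, r.SmoothOn U →
        DifferentiableAt ℝ (vfChart (fun y => (r y).1) x) (extChartAt I x x) ∧
        DifferentiableAt ℝ (covChart (fun y => (r y).2) x) (extChartAt I x x) := by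
      intro r hr
      obtain ⟨h1, h2⟩ := (genSection_smoothOn_iff r hU).1 hr x
      exact ⟨(h1.contDiffAt hmem).differentiableAt (by simp),
        (h2.contDiffAt hmem).differentiableAt (by simp)⟩
    -- The graph equations hold on a whole neighbourhood in the chart; this is needed since the
    -- bracket differentiates them.
    have hg : ∀ {r r' : GenSection I P}, InEigenspace (pairStructure σ Ω) ε r r' U →
        (covChart (fun y => (r y).2) x =ᶠ[𝓝 (extChartAt I x x)] fun w =>
          -(ε • flat (Ω.inChart x w) (vfChart (fun y => (r' y).1) x w)) -
            flat (σ.inChart x w) (vfChart (fun y => (r y).1) x w)) ∧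
        (covChart (fun y => (r' y).2) x =ᶠ[𝓝 (extChartAt I x x)] fun w =>
          ε • flat (Ω.inChart x w) (vfChart (fun y => (r y).1) x w) -
            flat (σ.inChart x w) (vfChart (fun y => (r' y).1) x w)) := by
      intro r r' hr
      have : ∀ w ∈ (extChartAt I x).target ∩ (extChartAt I x).symm ⁻¹' U,
          covChart (fun y => (r y).2) x w =
            -(ε • flat (Ω.inChart x w) (vfChart (fun y => (r' y).1) x w)) -
              flat (σ.inChart x w) (vfChart (fun y => (r y).1) x w) ∧
          covChart (fun y => (r' y).2) x w =
            ε • flat (Ω.inChart x w) (vfChart (fun y => (r y).1) x w) -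
              flat (σ.inChart x w) (vfChart (fun y => (r' y).1) x w) := by
        intro w hw
        obtain ⟨h1, h2⟩ := (pairMatrix_eigen_iff (E := E) (σ _)
          (h.symplectic.flat_isInvertible (hUW hw.2)) hε2 (r _) (r' _)).1 (hr _ hw.2)
        rw [← covChart_flat Ω _ hw.1, ← covChart_flat σ _ hw.1, ← covChart_flat Ω _ hw.1,
          ← covChart_flat σ _ hw.1]
        constructor
        · refine (congrArg (fun l : E →L[ℝ] ℝ => l ∘L tderiv I (extChartAt I x).symm w) h1).trans ?_
          ext Z; rfl
        · refine (congrArg (fun l : E →L[ℝ] ℝ => l ∘L tderiv I (extChartAt I x).symm w) h2).trans ?_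
          ext Z; rfl
      constructor
      · filter_upwards [hmem] with w hw using (this w hw).1
      · filter_upwards [hmem] with w hw using (this w hw).2
    obtain ⟨hX, hξ⟩ := hd hs
    obtain ⟨hX', hξ'⟩ := hd ht
    obtain ⟨hY, hη⟩ := hd hs'
    obtain ⟨hY', hη'⟩ := hd ht'
    obtain ⟨g1, g2⟩ := hg he
    obtain ⟨g3, g4⟩ := hg he'
    have hσd := (h.smooth.contDiffAt hW hxt (hUW hxU)).differentiableAt (by simp)
    have hΩd := (h.symplectic.smooth.contDiffAt hW hxt (hUW hxU)).differentiableAt (by simp)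
    have hσc := DiffForm.ClosedOn.extDeriv_inChart h.smooth hW h.closed hxt (hUW hxU)
    have hΩc := DiffForm.ClosedOn.extDeriv_inChart h.symplectic.smooth hW h.symplectic.closed hxt
      (hUW hxU)
    obtain ⟨r1, r2⟩ := halfCourant_graph hσd hΩd hσc hΩc hX hX' hY hY' g1 g2 g3 g4
    -- Composition with the derivative of the chart carries the graph identities `r1`, `r2` back to
    -- the fibre at `x`.
    have hflat : ∀ (τ : DiffForm I P 2) (N : E),
        flat (E := E) (τ x) N = flat (τ.inChart x (extChartAt I x x))
          (cderiv I (extChartAt I x) x N) ∘L cderiv I (extChartAt I x) x := by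
      intro τ N
      have h1 := covChart_flat τ (fun _ => N) hxt
      rw [vfChart_apply (fun _ => N) hxs] at h1
      rw [← h1]
      exact (covChart_comp_cderiv (fun y => flat (E := E) (τ y) N) hxs).symm
    have hN1 := (map_sub (cderiv I (extChartAt I x) x) (courant s s' x).1
        (courant t t' x).1).trans (congrArg₂ (· - ·) (courant_fst s s' x) (courant_fst t t' x))
    have hN2 := (map_add (cderiv I (extChartAt I x) x) (courant s t' x).1
        (courant t s' x).1).trans (congrArg₂ (· + ·) (courant_fst s t' x) (courant_fst t s' x))
    refine (pairMatrix_eigen_iff (E := E) (σ x) (h.symplectic.flat_isInvertible (hUW hx)) hε2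
      (courant s s' x - courant t t' x) (courant s t' x + courant t s' x)).2 ⟨?_, ?_⟩
    · refine (congrArg₂ (fun a b : E →L[ℝ] ℝ => a - b) (courant_snd s s' hX hξ hY hη)
        (courant_snd t t' hX' hξ' hY' hη')).trans ?_
      refine Eq.trans ?_ (congrArg₂ (fun a b : E →L[ℝ] ℝ => -(ε • a) - b)
        (hflat Ω (courant s t' x + courant t s' x).1)
        (hflat σ (courant s s' x - courant t t' x).1)).symm
      refine Eq.trans (congrArg (fun l : E →L[ℝ] ℝ => l ∘L cderiv I (extChartAt I x) x) r1) ?_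
      rw [← hN1, ← hN2]
      rfl
    · refine (congrArg₂ (fun a b : E →L[ℝ] ℝ => a + b) (courant_snd s t' hX hξ hY' hη')
        (courant_snd t s' hX' hξ' hY hη)).trans ?_
      refine Eq.trans ?_ (congrArg₂ (fun a b : E →L[ℝ] ℝ => ε • a - b)
        (hflat Ω (courant s s' x - courant t t' x).1)
        (hflat σ (courant s t' x + courant t s' x).1)).symm
      refine Eq.trans (congrArg (fun l : E →L[ℝ] ℝ => l ∘L cderiv I (extChartAt I x) x) r2) ?_
      rw [← hN1, ← hN2]
      rfl

end Hitchin

/-! ### Preferred charts of `T*M` and the Liouville form -/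

section CotangentCharts

variable {M : Type*} [TopologicalSpace M] [ChartedSpace Plane M] [IsManifold (𝓡 2) ∞ M]

/-- The covector `p`, as a linear form on the model space. -/
def momentum (p : Phase M) : Plane →L[ℝ] ℝ := p.2

/-- The point of the phase space over `q` given by a linear form on the model space. -/
def phasePoint (q : M) (a : Plane →L[ℝ] ℝ) : Phase M := ⟨q, a⟩

theorem inCoordinates_eq {q₀ q : M} (hq : q ∈ (extChartAt (𝓡 2) q₀).source)
    (ϕ : Plane →L[ℝ] ℝ) :
    ContinuousLinearMap.inCoordinates Plane (TangentSpace (𝓡 2) (M := M)) ℝ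
      (Bundle.Trivial M ℝ) q₀ q q₀ q ϕ =
      ϕ ∘L tderiv (𝓡 2) (extChartAt (𝓡 2) q₀).symm (extChartAt (𝓡 2) q₀ q) := by
  rw [extChartAt_source] at hq
  unfold ContinuousLinearMap.inCoordinates tderiv
  rw [TangentBundle.symmL_trivializationAt hq, (𝓡 2).range_eq_univ, mfderivWithin_univ]
  have h : Bundle.Trivialization.continuousLinearMapAt ℝ
      (trivializationAt ℝ (Bundle.Trivial M ℝ) q₀) q = ContinuousLinearMap.id ℝ ℝ :=
    Bundle.Trivial.continuousLinearMapAt_trivialization ℝ M ℝ q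
  rw [h]
  rfl

theorem phase_extChartAt_source (p₀ : Phase M) :
    (extChartAt phaseModel p₀).source = {p | p.1 ∈ (extChartAt (𝓡 2) p₀.1).source} := by
  ext p
  rw [FiberBundle.extChartAt]
  simp only [PartialEquiv.trans_source, PartialEquiv.prod_source, PartialEquiv.refl_source,
    Set.mem_inter_iff, Set.mem_preimage, Set.mem_prod, Set.mem_univ, and_true, Set.mem_ofPred_eq]
  change p ∈ (trivializationAt (Plane →L[ℝ] ℝ) (fun x : M =>
    TangentSpace (𝓡 2) x →L[ℝ] Bundle.Trivial M ℝ x) p₀.proj).source ∧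
      p.1 ∈ (extChartAt (𝓡 2) p₀.1).source ↔ p.1 ∈ (extChartAt (𝓡 2) p₀.1).source
  rw [and_iff_right_iff_imp, Bundle.Trivialization.mem_source, hom_trivializationAt_baseSet,
    TangentBundle.trivializationAt_baseSet, extChartAt_source]
  exact fun h => ⟨h, Set.mem_univ _⟩

/-- The preferred charts of the bundle are canonical coordinates `(q, p)`: the trivialization
composes a covector with the derivative of the inverse base chart. -/
theorem phase_extChartAt (p₀ : Phase M) {p : Phase M}
    (hp : p.1 ∈ (extChartAt (𝓡 2) p₀.1).source) :
    extChartAt phaseModel p₀ p = (extChartAt (𝓡 2) p₀.1 p.1,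
      momentum p ∘L tderiv (𝓡 2) (extChartAt (𝓡 2) p₀.1).symm (extChartAt (𝓡 2) p₀.1 p.1)) := by
  rw [← inCoordinates_eq hp (momentum p), FiberBundle.extChartAt]
  rfl

theorem contMDiffAt_phasePoint {E' : Type*} [NormedAddCommGroup E'] [NormedSpace ℝ E']
    {H' : Type*} [TopologicalSpace H'] {I' : ModelWithCorners ℝ E' H'} {N : Type*}
    [TopologicalSpace N] [ChartedSpace H' N] {f : N → M} {a : N → Plane →L[ℝ] ℝ} {x : N}
    (hf : ContMDiffAt I' (𝓡 2) ∞ f x)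
    (ha : ContMDiffAt I' 𝓘(ℝ, Plane →L[ℝ] ℝ) ∞ (fun y => a y ∘L
      tderiv (𝓡 2) (extChartAt (𝓡 2) (f x)).symm (extChartAt (𝓡 2) (f x) (f y))) x) :
    ContMDiffAt I' phaseModel ∞ (fun y => phasePoint (f y) (a y)) x := by
  rw [contMDiffAt_hom_bundle]
  refine ⟨hf, ha.congr_of_eventuallyEq ?_⟩
  filter_upwards [hf.continuousAt.preimage_mem_nhds
    ((isOpen_extChartAt_source (I := 𝓡 2) (f x)).mem_nhds (mem_extChartAt_source (f x)))] with y hy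
  exact inCoordinates_eq hy (a y)

theorem contMDiff_phaseProj : ContMDiff phaseModel (𝓡 2) ∞ (fun p : Phase M => p.1) :=
  Bundle.contMDiff_proj _

/-- The tautological property of `θ`, by the chain rule for `π ∘ F`. It gives both `θ = p dq` in
charts and `(df)^*θ = df`. -/
theorem covector_comp_liouville {E' : Type*} [NormedAddCommGroup E'] [NormedSpace ℝ E']
    {F : E' → Phase M} {z : E'} (hF : MDifferentiableAt 𝓘(ℝ, E') phaseModel F z) :
    (show Plane × (Plane →L[ℝ] ℝ) →L[ℝ] ℝ from liouville M (F z)) ∘L tderiv phaseModel F z =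
      momentum (F z) ∘L tderiv (𝓡 2) (fun w => (F w).1) z := by
  have h := mfderiv_comp z (contMDiff_phaseProj.mdifferentiable (by simp) (F z)) hF
  have h2 : tderiv (𝓡 2) (fun w => (F w).1) z = _ := h
  rw [h2]
  rfl

theorem covChart_liouville (p₀ : Phase M) {y : Plane × (Plane →L[ℝ] ℝ)}
    (hy : y ∈ (extChartAt phaseModel p₀).target) :
    covChart (liouville M) p₀ y = y.2 ∘L ContinuousLinearMap.fst ℝ Plane (Plane →L[ℝ] ℝ) := by
  have hsrc : ∀ w ∈ (extChartAt phaseModel p₀).target,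
      ((extChartAt phaseModel p₀).symm w).1 ∈ (extChartAt (𝓡 2) p₀.1).source := fun w hw => by
    have := (extChartAt phaseModel p₀).map_target hw
    rwa [phase_extChartAt_source] at this
  have h1 : ∀ w ∈ (extChartAt phaseModel p₀).target,
      w = (extChartAt (𝓡 2) p₀.1 ((extChartAt phaseModel p₀).symm w).1,
        momentum ((extChartAt phaseModel p₀).symm w) ∘L
          tderiv (𝓡 2) (extChartAt (𝓡 2) p₀.1).symm
            (extChartAt (𝓡 2) p₀.1 ((extChartAt phaseModel p₀).symm w).1)) := fun w hw => by
    rw [← phase_extChartAt p₀ (hsrc w hw), (extChartAt phaseModel p₀).right_inv hw]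
  have h2 : (fun w => ((extChartAt phaseModel p₀).symm w).1) =ᶠ[𝓝 y]
      (extChartAt (𝓡 2) p₀.1).symm ∘ Prod.fst := by
    filter_upwards [(isOpen_extChartAt_target (I := phaseModel) p₀).mem_nhds hy] with w hw
    have := congrArg (fun v => (extChartAt (𝓡 2) p₀.1).symm (Prod.fst v)) (h1 w hw)
    refine Eq.trans ?_ this.symm
    exact ((extChartAt (𝓡 2) p₀.1).left_inv (hsrc w hw)).symm
  have hy1 : y.1 ∈ (extChartAt (𝓡 2) p₀.1).target := by
    rw [h1 y hy]; exact (extChartAt (𝓡 2) p₀.1).map_source (hsrc y hy)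
  refine (covector_comp_liouville (mdifferentiableAt_chart_symm hy)).trans ?_
  rw [tderiv_congr h2, tderiv_comp (mdifferentiableAt_chart_symm hy1) differentiableAt_fst,
    fderiv_fst, ← ContinuousLinearMap.comp_assoc]
  congr 1
  have e1 := congrArg Prod.fst (h1 y hy)
  have e2 := congrArg Prod.snd (h1 y hy)
  refine Eq.trans ?_ e2.symm
  rw [e1]

end CotangentCharts

/-! ### The form `σ + gΩ` and its exterior derivative -/

section FormAlgebra

variable {E : Type*} [NormedAddCommGroup E] [NormedSpace ℝ E] {H : Type*} [TopologicalSpace H]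
  {I : ModelWithCorners ℝ E H} {P : Type*} [TopologicalSpace P] [ChartedSpace H P]

theorem extDeriv_add_smul {σ Ω : E → E [⋀^Fin 2]→L[ℝ] ℝ} {g : E → ℝ} {u : E}
    (hσ : DifferentiableAt ℝ σ u) (hΩ : DifferentiableAt ℝ Ω u) (hg : DifferentiableAt ℝ g u) :
    extDeriv (fun w => σ w + g w • Ω w) u =
      extDeriv σ u + wedge (fderiv ℝ g u) (Ω u) + g u • extDeriv Ω u := by
  have hf : ∀ Z, fderiv ℝ (fun w => σ w + g w • Ω w) u Z =
      fderiv ℝ σ u Z + (fderiv ℝ g u Z • Ω u + g u • fderiv ℝ Ω u Z) := by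
    intro Z
    have h : HasFDerivAt (fun w => σ w + g w • Ω w) _ u :=
      hσ.hasFDerivAt.add (hg.hasFDerivAt.smul hΩ.hasFDerivAt)
    rw [h.fderiv]
    simp only [add_apply, smul_apply, ContinuousLinearMap.smulRight_apply]
    abel
  ext v
  have hv : v = ![v 0, v 1, v 2] := by ext i; fin_cases i <;> rfl
  rw [hv]
  change _ = extDeriv σ u _ + wedge (fderiv ℝ g u) (Ω u) _ + g u * extDeriv Ω u _
  rw [extDeriv_two_apply, extDeriv_two_apply, extDeriv_two_apply, wedge_apply, hf, hf, hf]
  simp only [flat_apply, ContinuousAlternatingMap.add_apply, ContinuousAlternatingMap.smul_apply,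
    smul_eq_mul]
  ring

variable [I.Boundaryless]

theorem inChart_add_smul {k : ℕ} (σ τ : DiffForm I P k) (g : P → ℝ) (x₀ : P) (y : E) :
    DiffForm.inChart (I := I) (fun p => σ p + g p • τ p) x₀ y =
      σ.inChart x₀ y + g ((extChartAt I x₀).symm y) • τ.inChart x₀ y := by
  simp only [inChart_eq_pull]
  rfl

theorem inChart_neg {k : ℕ} (σ : DiffForm I P k) (x₀ : P) (y : E) :
    DiffForm.inChart (I := I) (fun p => -σ p) x₀ y = -σ.inChart x₀ y := by
  simp only [inChart_eq_pull]
  rfl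

variable [IsManifold I ∞ P]

variable {W : Set P} {σ Ω : DiffForm I P 2} {g : P → ℝ}

theorem contDiffAt_comp_chart_symm (hg : ContMDiffOn I 𝓘(ℝ, ℝ) ∞ g W) (hW : IsOpen W) {x₀ : P}
    {y : E} (hy : y ∈ (extChartAt I x₀).target) (hyW : (extChartAt I x₀).symm y ∈ W) :
    ContDiffAt ℝ ∞ (fun w => g ((extChartAt I x₀).symm w)) y := by
  rw [← contMDiffAt_iff_contDiffAt]
  exact ContMDiffAt.comp y (hg.contMDiffAt (hW.mem_nhds hyW)) (contMDiffAt_chart_symm hy)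

theorem smoothOn_add_smul (hσ : σ.SmoothOn W) (hΩ : Ω.SmoothOn W)
    (hg : ContMDiffOn I 𝓘(ℝ, ℝ) ∞ g W) (hW : IsOpen W) :
    DiffForm.SmoothOn (I := I) (fun p => σ p + g p • Ω p) W := by
  intro x₀
  have h : ContDiffOn ℝ ∞ (fun y => σ.inChart x₀ y + g ((extChartAt I x₀).symm y) •
      Ω.inChart x₀ y) ((extChartAt I x₀).target ∩ (extChartAt I x₀).symm ⁻¹' W) :=
    (hσ x₀).add (ContDiffOn.smul (fun y hy =>
      (contDiffAt_comp_chart_symm hg hW hy.1 hy.2).contDiffWithinAt) (hΩ x₀))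
  exact h.congr fun y _ => inChart_add_smul σ Ω g x₀ y

theorem dFun_comp_tderiv (hg : ContMDiffOn I 𝓘(ℝ, ℝ) ∞ g W) (hW : IsOpen W) {x₀ : P} {y : E}
    (hy : y ∈ (extChartAt I x₀).target) (hyW : (extChartAt I x₀).symm y ∈ W) :
    fderiv ℝ (fun w => g ((extChartAt I x₀).symm w)) y = covChart (dFun I g) x₀ y :=
  fderiv_comp_eq (F := (extChartAt I x₀).symm) (φ := g)
    ((hg.contMDiffAt (hW.mem_nhds hyW)).mdifferentiableAt (by simp))
    (mdifferentiableAt_chart_symm hy)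

/-- If `dσ = dg ∧ Ω` with `Ω` closed, then `σ - g Ω` is closed. -/
theorem closedOn_sub_smul (hσ : σ.SmoothOn W) (hΩ : Ω.SmoothOn W) (hΩc : Ω.ClosedOn W)
    (hg : ContMDiffOn I 𝓘(ℝ, ℝ) ∞ g W) (hW : IsOpen W)
    (hd : ∀ x ∈ W, σ.d x = wedge (E := E) (dFun I g x) (Ω x)) :
    DiffForm.ClosedOn (I := I) (fun p => σ p + (-g p) • Ω p) W := by
  intro x hx
  have hxt := mem_extChartAt_target (I := I) x
  have hxW : (extChartAt I x).symm (extChartAt I x x) ∈ W := by simpa using hx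
  have hg' : ContMDiffOn I 𝓘(ℝ, ℝ) ∞ (fun p => -g p) W := fun p hp => (hg p hp).neg
  apply eq_zero_of_inChart
  rw [d_inChart (smoothOn_add_smul hσ hΩ hg' hW) hW hxt hxW]
  have h1 : DiffForm.inChart (I := I) (fun p => σ p + (-g p) • Ω p) x = fun w =>
      σ.inChart x w + (-g ((extChartAt I x).symm w)) • Ω.inChart x w :=
    funext fun w => inChart_add_smul σ Ω (fun p => -g p) x w
  have hgd : DifferentiableAt ℝ (fun w => -g ((extChartAt I x).symm w)) (extChartAt I x x) :=
    ((contDiffAt_comp_chart_symm hg hW hxt hxW).differentiableAt (by simp)).fun_neg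
  rw [h1, extDeriv_add_smul ((hσ.contDiffAt hW hxt hxW).differentiableAt (by simp))
    ((hΩ.contDiffAt hW hxt hxW).differentiableAt (by simp)) hgd,
    DiffForm.ClosedOn.extDeriv_inChart hΩ hW hΩc hxt hxW, smul_zero, add_zero, fderiv_fun_neg,
    dFun_comp_tderiv hg hW hxt hxW, ← d_inChart hσ hW hxt hxW, inChart_eq_pull, inChart_eq_pull]
  have h2 : pull (extChartAt I x).symm σ.d (extChartAt I x x) =
      wedge (covChart (dFun I g) x (extChartAt I x x))
        (pull (extChartAt I x).symm Ω (extChartAt I x x)) :=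
    (congrArg (fun τ : E [⋀^Fin 3]→L[ℝ] ℝ => τ.compContinuousLinearMap
      (tderiv I (extChartAt I x).symm (extChartAt I x x))) (hd _ hxW)).trans
      (wedge_compContinuousLinearMap _ _ _)
  rw [h2, ← wedgeₗ_apply, ← wedgeₗ_apply, map_neg, add_neg_cancel]

end FormAlgebra

/-! ### The canonical form is symplectic -/

section Canonical

variable {M : Type*} [TopologicalSpace M] [ChartedSpace Plane M] [IsManifold (𝓡 2) ∞ M]

theorem liouville_smoothOn : (liouville M).toForm.SmoothOn Set.univ := by
  rw [toForm_smoothOn_iff]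
  intro p₀
  have h : ContDiff ℝ ∞ (fun y : Plane × (Plane →L[ℝ] ℝ) =>
      y.2 ∘L ContinuousLinearMap.fst ℝ Plane (Plane →L[ℝ] ℝ)) :=
    contDiff_snd.clm_comp contDiff_const
  exact h.contDiffOn.congr fun y hy => covChart_liouville p₀ hy.1

theorem canonicalForm_inChart (p₀ : Phase M) {y : Plane × (Plane →L[ℝ] ℝ)}
    (hy : y ∈ (extChartAt phaseModel p₀).target) (A B : Plane × (Plane →L[ℝ] ℝ)) :
    flat ((canonicalForm M).inChart p₀ y) A B = B.2 A.1 - A.2 B.1 := by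
  have h1 : (canonicalForm M).inChart p₀ y = -(liouville M).toForm.d.inChart p₀ y :=
    inChart_neg _ _ _
  rw [h1, d_inChart liouville_smoothOn isOpen_univ hy (Set.mem_univ _)]
  have h2 : (liouville M).toForm.inChart p₀ =ᶠ[𝓝 y] fun w =>
      ContinuousAlternatingMap.ofSubsingleton ℝ _ ℝ (0 : Fin 1)
        (w.2 ∘L ContinuousLinearMap.fst ℝ Plane (Plane →L[ℝ] ℝ)) := by
    filter_upwards [(isOpen_extChartAt_target (I := phaseModel) p₀).mem_nhds hy] with w hw
    rw [toForm_inChart, covChart_liouville p₀ hw]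
  have h3 : ∀ Z, fderiv ℝ (fun w : Plane × (Plane →L[ℝ] ℝ) =>
      w.2 ∘L ContinuousLinearMap.fst ℝ Plane (Plane →L[ℝ] ℝ)) y Z =
      Z.2 ∘L ContinuousLinearMap.fst ℝ Plane (Plane →L[ℝ] ℝ) := by
    intro Z
    rw [fderiv_clm_comp differentiableAt_snd (differentiableAt_const _)]
    simp [fderiv_snd]
  rw [h2.extDeriv_eq, flat_apply, ContinuousAlternatingMap.neg_apply, ← flat_apply,
    extDeriv_one_apply (differentiableAt_snd.clm_comp (differentiableAt_const _)), h3, h3]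
  simp

/-- Constant coefficients, common to all preferred charts: this yields `dΩ = 0` and lets one left
inverse serve a whole chart in `botD_smoothOn`. -/
theorem canonicalForm_inChart_eq (p₀ p₁ : Phase M) {y z : Plane × (Plane →L[ℝ] ℝ)}
    (hy : y ∈ (extChartAt phaseModel p₀).target) (hz : z ∈ (extChartAt phaseModel p₁).target) :
    (canonicalForm M).inChart p₀ y = (canonicalForm M).inChart p₁ z :=
  form_ext (ContinuousLinearMap.ext fun A => ContinuousLinearMap.ext fun B => by
    rw [canonicalForm_inChart p₀ hy, canonicalForm_inChart p₁ hz])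

theorem canonicalForm_smoothOn : (canonicalForm M).SmoothOn Set.univ := fun p₀ =>
  ((liouville_smoothOn (M := M)).d isOpen_univ p₀).neg.congr fun _ _ => inChart_neg _ _ _

theorem canonicalForm_isSymplecticOn : IsSymplecticOn phaseModel (canonicalForm M) Set.univ where
  smooth := canonicalForm_smoothOn
  closed x _ := by
    have hxt := mem_extChartAt_target (I := phaseModel) x
    apply eq_zero_of_inChart
    rw [d_inChart canonicalForm_smoothOn isOpen_univ hxt (Set.mem_univ _)]
    have h : (canonicalForm M).inChart x =ᶠ[𝓝 (extChartAt phaseModel x x)] fun _ =>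
        (canonicalForm M).inChart x (extChartAt phaseModel x x) := by
      filter_upwards [(isOpen_extChartAt_target (I := phaseModel) x).mem_nhds hxt] with w hw
      exact canonicalForm_inChart_eq x x hw hxt
    rw [h.extDeriv_eq, extDeriv, fderiv_const_apply]
    exact map_zero (ContinuousAlternatingMap.alternatizeUncurryFinCLM ℝ _ ℝ)
  nondegenerate x _ X hX := by
    have hxt := mem_extChartAt_target (I := phaseModel) x
    have hxs := mem_extChartAt_source (I := phaseModel) x
    let D := cderiv phaseModel (extChartAt phaseModel x) x
    have h1 : ∀ B : Plane × (Plane →L[ℝ] ℝ), B.2 (D X).1 - (D X).2 B.1 = 0 := fun B => by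
      have h := flat_inChart (canonicalForm M) X B hxt
      rw [(extChartAt phaseModel x).left_inv hxs] at h
      rw [← canonicalForm_inChart x hxt]
      exact h.trans ((flat_apply (E := Plane × (Plane →L[ℝ] ℝ)) _ _ _).trans (hX _))
    have h2 : D X = 0 := by
      refine Prod.ext ?_ (ContinuousLinearMap.ext fun b => ?_)
      · by_contra hne
        -- Pairing with `(0, g)`, where `g` is a norming functional, forces the `q`-part to vanish;
        -- pairing with `(b, 0)` then handles the `p`-part.
        obtain ⟨g, _, hg⟩ := exists_dual_vector ℝ (D X).1 (norm_ne_zero_iff.2 hne)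
        have := h1 (0, g)
        rw [hg] at this
        simp at this
        exact hne this
      · have := h1 (b, 0)
        simpa using this
    have h3 := congrArg (fun l : Plane × (Plane →L[ℝ] ℝ) →L[ℝ] Plane × (Plane →L[ℝ] ℝ) => l X)
      (tderiv_cderiv_chart hxs)
    refine h3.symm.trans ?_
    exact (congrArg (tderiv phaseModel (extChartAt phaseModel x).symm
      (extChartAt phaseModel x x)) h2).trans (map_zero _)

end Canonical

/-! ### The 1-form `⊥dσ` and the correction of `σ` -/

section Divergent

variable {M : Type*} [TopologicalSpace M] [ChartedSpace Plane M] [IsManifold (𝓡 2) ∞ M]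

theorem finrank_phase : Module.finrank ℝ (Plane × (Plane →L[ℝ] ℝ)) = 4 := by
  rw [Module.finrank_prod,
    ← (LinearMap.toContinuousLinearMap : (Plane →ₗ[ℝ] ℝ) ≃ₗ[ℝ] (Plane →L[ℝ] ℝ)).finrank_eq]
  simp [Plane]

/-- The 1-form `⊥ dσ`. -/
def botD (σ : DiffForm phaseModel (Phase M) 2) : CovectorField phaseModel (Phase M) :=
  fun p => bot (E := Plane × (Plane →L[ℝ] ℝ)) (canonicalForm M p) (σ.d p)

theorem wedge_botD (σ : DiffForm phaseModel (Phase M) 2) (p : Phase M) :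
    wedge (E := Plane × (Plane →L[ℝ] ℝ)) (botD σ p) (canonicalForm M p) = σ.d p :=
  wedge_bot finrank_phase (canonicalForm_isSymplecticOn.flat_isInvertible (Set.mem_univ p)) _

theorem wedge_covChart_botD (σ : DiffForm phaseModel (Phase M) 2) (p₀ : Phase M)
    (y : Plane × (Plane →L[ℝ] ℝ)) :
    wedge (covChart (botD σ) p₀ y) ((canonicalForm M).inChart p₀ y) = σ.d.inChart p₀ y := by
  rw [inChart_eq_pull, inChart_eq_pull]
  refine (wedge_compContinuousLinearMap _ _ _).symm.trans ?_
  exact congrArg (fun τ : (Plane × (Plane →L[ℝ] ℝ)) [⋀^Fin 3]→L[ℝ] ℝ =>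
    τ.compContinuousLinearMap (tderiv phaseModel (extChartAt phaseModel p₀).symm y))
    (wedge_botD σ _)

/-- The pointwise choice in `bot` carries no regularity, but in a canonical chart `Ω` is constant,
so `⊥dσ = R(dσ)` for a fixed linear `R`. -/
theorem botD_smoothOn {σ : DiffForm phaseModel (Phase M) 2} (hσ : σ.SmoothOn Set.univ) :
    (botD σ).toForm.SmoothOn Set.univ := by
  rw [toForm_smoothOn_iff]
  intro p₀
  have hp := mem_extChartAt_target (I := phaseModel) p₀
  obtain ⟨R, hR⟩ := exists_wedge_leftInverse (by rw [finrank_phase]; norm_num)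
    (canonicalForm_isSymplecticOn.flat_inChart_isInvertible hp (Set.mem_univ _))
  refine (R.contDiff.comp_contDiffOn (hσ.d isOpen_univ p₀)).congr fun y hy => ?_
  change _ = R (σ.d.inChart p₀ y)
  rw [← wedge_covChart_botD, canonicalForm_inChart_eq p₀ p₀ hy.1 hp, hR]

theorem contMDiffOn_dSection {f : M → ℝ} {V : Set M} (hV : IsOpen V)
    (hf : ContMDiffOn (𝓡 2) 𝓘(ℝ, ℝ) ∞ f V) : ContMDiffOn (𝓡 2) phaseModel ∞ (dSection f) V := by
  intro q hq
  refine ContMDiffAt.contMDiffWithinAt ?_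
  refine contMDiffAt_phasePoint (f := fun x : M => x) (a := fun x => dFun (𝓡 2) f x)
    contMDiffAt_id ?_
  have hqs := mem_extChartAt_source (I := 𝓡 2) q
  have h1 : ContDiffAt ℝ ∞ (fderiv ℝ (fun w => f ((extChartAt (𝓡 2) q).symm w)))
      (extChartAt (𝓡 2) q q) :=
    (contDiffAt_comp_chart_symm hf hV (mem_extChartAt_target q)
      (by simpa using hq)).fderiv_right (by simp)
  have h2 := ContMDiffAt.comp q h1.contMDiffAt (contMDiffAt_chart hqs)
  refine h2.congr_of_eventuallyEq ?_
  filter_upwards [(isOpen_extChartAt_source (I := 𝓡 2) q).mem_nhds hqs, hV.mem_nhds hq]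
    with x hx hxV
  have hxl := (extChartAt (𝓡 2) q).left_inv hx
  refine Eq.trans ?_ (dFun_comp_tderiv hf hV ((extChartAt (𝓡 2) q).map_source hx)
    (by rwa [hxl])).symm
  let a : M → Plane →L[ℝ] ℝ := fun x => dFun (𝓡 2) f x
  change a x ∘L _ = a ((extChartAt (𝓡 2) q).symm (extChartAt (𝓡 2) q x)) ∘L _
  rw [hxl]

theorem pull_dSection_liouville {f : M → ℝ} {V : Set M} (hV : IsOpen V)
    (hf : ContMDiffOn (𝓡 2) 𝓘(ℝ, ℝ) ∞ f V) {q : M} {y : Plane}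
    (hy : y ∈ (extChartAt (𝓡 2) q).target) (hyV : (extChartAt (𝓡 2) q).symm y ∈ V) :
    pull (dSection f ∘ (extChartAt (𝓡 2) q).symm) (liouville M).toForm y =
      ContinuousAlternatingMap.ofSubsingleton ℝ Plane ℝ (0 : Fin 1)
        (fderiv ℝ (fun w => f ((extChartAt (𝓡 2) q).symm w)) y) := by
  have hF : MDifferentiableAt 𝓘(ℝ, Plane) phaseModel
      (dSection f ∘ (extChartAt (𝓡 2) q).symm) y :=
    (((contMDiffOn_dSection hV hf).contMDiffAt (hV.mem_nhds hyV)).comp y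
      (contMDiffAt_chart_symm hy)).mdifferentiableAt (by simp)
  exact congrArg (ContinuousAlternatingMap.ofSubsingleton ℝ Plane ℝ (0 : Fin 1))
    ((covector_comp_liouville hF).trans (dFun_comp_tderiv hf hV hy hyV).symm)

/-- The graph of a differential is Lagrangian. -/
theorem mongeAmpere_canonicalForm {f : M → ℝ} {V : Set M} (hV : IsOpen V)
    (hf : ContMDiffOn (𝓡 2) 𝓘(ℝ, ℝ) ∞ f V) {q : M} (hq : q ∈ V) :
    mongeAmpere (canonicalForm M) f q = 0 := by
  have hy := mem_extChartAt_target (I := 𝓡 2) q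
  have hyV : (extChartAt (𝓡 2) q).symm (extChartAt (𝓡 2) q q) ∈ V := by simpa using hq
  have hU := isOpen_chart_preimage (I := 𝓡 2) q hV
  have hF : ContMDiffOn 𝓘(ℝ, Plane) phaseModel ∞ (dSection f ∘ (extChartAt (𝓡 2) q).symm)
      ((extChartAt (𝓡 2) q).target ∩ (extChartAt (𝓡 2) q).symm ⁻¹' V) := fun y hy =>
    (((contMDiffOn_dSection hV hf).contMDiffAt (hV.mem_nhds hy.2)).comp y
      (contMDiffAt_chart_symm hy.1)).contMDiffWithinAt
  have h1 : pull (dSection f ∘ (extChartAt (𝓡 2) q).symm) (liouville M).toForm.d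
      (extChartAt (𝓡 2) q q) = 0 := by
    rw [← extDeriv_pull liouville_smoothOn isOpen_univ hU hF ⟨hy, hyV⟩ (Set.mem_univ _)]
    have h2 : pull (dSection f ∘ (extChartAt (𝓡 2) q).symm) (liouville M).toForm
        =ᶠ[𝓝 (extChartAt (𝓡 2) q q)] fun w =>
        ContinuousAlternatingMap.ofSubsingleton ℝ Plane ℝ (0 : Fin 1)
          (fderiv ℝ (fun w => f ((extChartAt (𝓡 2) q).symm w)) w) := by
      filter_upwards [hU.mem_nhds ⟨hy, hyV⟩] with w hw
      exact pull_dSection_liouville hV hf hw.1 hw.2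
    have hg := contDiffAt_comp_chart_symm hf hV hy hyV
    have h0 : flat (0 : Plane [⋀^Fin 2]→L[ℝ] ℝ) = 0 := flatL.map_zero
    refine form_ext (ContinuousLinearMap.ext fun A => ContinuousLinearMap.ext fun B => ?_)
    rw [h2.extDeriv_eq, extDeriv_one_apply ((hg.fderiv_right (m := ∞)
      (by simp)).differentiableAt (by simp)), h0]
    -- `d(df) = 0`, as symmetry of the second derivative.
    exact sub_eq_zero.2 (hg.isSymmSndFDerivAt two_le_smooth A B)
  apply eq_zero_of_inChart
  rw [inChart_eq_pull]
  have h3 : pull (extChartAt (𝓡 2) q).symm (mongeAmpere (canonicalForm M) f)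
      (extChartAt (𝓡 2) q q) =
      -pull (dSection f ∘ (extChartAt (𝓡 2) q).symm) (liouville M).toForm.d
        (extChartAt (𝓡 2) q q) := by
    have h4 := mfderiv_comp (extChartAt (𝓡 2) q q)
      (((contMDiffOn_dSection hV hf).contMDiffAt (hV.mem_nhds hyV)).mdifferentiableAt (by simp))
      (mdifferentiableAt_chart_symm hy)
    unfold pull
    have h5 : tderiv phaseModel (dSection f ∘ (extChartAt (𝓡 2) q).symm)
      (extChartAt (𝓡 2) q q) = _ := h4
    rw [h5]
    rfl
  rw [h3, h1, neg_zero]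

/-- With `μ = -g` one gets `dσ' = (⊥dσ - dg) ∧ Ω = 0`; the added multiple of `Ω` vanishes on graphs
of differentials. -/
theorem givesHitchinPairOn_of_botD_eq {σ : DiffForm phaseModel (Phase M) 2}
    (hσ : σ.SmoothOn Set.univ) {W : Set (Phase M)} (hW : IsOpen W) {g : Phase M → ℝ}
    (hg : ContMDiffOn phaseModel 𝓘(ℝ, ℝ) ∞ g W) (hα : ∀ p ∈ W, botD σ p = dFun phaseModel g p) :
    GivesHitchinPairOn σ W := by
  have hs := canonicalForm_isSymplecticOn (M := M)
  have hΩ : IsSymplecticOn phaseModel (canonicalForm M) W :=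
    ⟨hs.smooth.mono (Set.subset_univ W), fun x _ => hs.closed x (Set.mem_univ x),
      fun x _ => hs.nondegenerate x (Set.mem_univ x)⟩
  have hσW := hσ.mono (Set.subset_univ W)
  have hg' : ContMDiffOn phaseModel 𝓘(ℝ, ℝ) ∞ (fun p => -g p) W := fun p hp => (hg p hp).neg
  have hd : ∀ p ∈ W, σ.d p =
      wedge (E := Plane × (Plane →L[ℝ] ℝ)) (dFun phaseModel g p) (canonicalForm M p) :=
    fun p hp => by rw [← hα p hp]; exact (wedge_botD σ p).symm
  have hpair : IsHitchinPairOn phaseModel (fun p => σ p + (-g p) • canonicalForm M p)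
      (canonicalForm M) W :=
    ⟨hΩ, smoothOn_add_smul hσW hΩ.smooth hg' hW,
      closedOn_sub_smul hσW hΩ.smooth hΩ.closed hg hW hd⟩
  refine ⟨fun p => -g p, hg', fun p => σ p + (-g p) • canonicalForm M p, fun _ => rfl, ?_, hpair,
    hpair.isGenComplexOn hW⟩
  intro V hV f hf q hq _
  have h := mongeAmpere_canonicalForm hV hf hq
  have h2 : mongeAmpere (fun p => σ p + (-g p) • canonicalForm M p) f q =
    mongeAmpere σ f q + (-g (dSection f q)) • mongeAmpere (canonicalForm M) f q := rfl
  rw [h2, h, smul_zero, add_zero]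

end Divergent

/-! ### The Poincaré lemma for 1-forms -/

section Poincare

variable {E : Type*} [NormedAddCommGroup E] [NormedSpace ℝ E] {H : Type*} [TopologicalSpace H]
  {I : ModelWithCorners ℝ E H} {P : Type*} [TopologicalSpace P] [ChartedSpace H P]
  [I.Boundaryless] [IsManifold I ∞ P] {E' : Type*} [NormedAddCommGroup E'] [NormedSpace ℝ E']

/-- A closed 1-form is exact over a set that is smoothly parametrized by an open convex set. -/
theorem exists_eq_dFun_of_convex {W : Set P} (hW : IsOpen W) {U : Set E'} (hU : IsOpen U)
    (hUc : Convex ℝ U) {Φ : P → E'} {Ψ : E' → P} (hΦ : ContMDiffOn I 𝓘(ℝ, E') ∞ Φ W)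
    (hΨ : ContMDiffOn 𝓘(ℝ, E') I ∞ Ψ U) (hΦU : Set.MapsTo Φ W U) (hΨW : Set.MapsTo Ψ U W)
    (hΨΦ : ∀ p ∈ W, Ψ (Φ p) = p) {α : CovectorField I P} (hα : α.toForm.SmoothOn W)
    (hαc : α.toForm.ClosedOn W) :
    ∃ g : P → ℝ, ContMDiffOn I 𝓘(ℝ, ℝ) ∞ g W ∧ ∀ p ∈ W, α p = dFun I g p := by
  let α' : P → E →L[ℝ] ℝ := α
  let β : E' → E' →L[ℝ] ℝ := fun z => α' (Ψ z) ∘L tderiv I Ψ z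
  have hβ : pull Ψ α.toForm =
      fun z => ContinuousAlternatingMap.ofSubsingleton ℝ E' ℝ (0 : Fin 1) (β z) := rfl
  have hβs : ContDiffOn ℝ ∞ β U := by
    intro z hz
    have h := contDiffAt_pull hα hW hU hΨ hz (hΨW hz)
    let e := (ContinuousAlternatingMap.ofSubsingletonLIE (𝕜 := ℝ) (E := E') (F := ℝ)
      (0 : Fin 1)).toContinuousLinearEquiv
    have h2 := (e.symm.contDiff.contDiffAt.comp z h).contDiffWithinAt (s := U)
    refine h2.congr_of_mem (fun w _ => ?_) hz
    exact (e.symm_apply_apply (β w)).symm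
  have hβd : DifferentiableOn ℝ β U := hβs.differentiableOn (by simp)
  have hsymm : ∀ z ∈ U, ∀ A B, fderiv ℝ β z A B = fderiv ℝ β z B A := by
    intro z hz A B
    rw [← sub_eq_zero, ← extDeriv_one_apply (hβd.differentiableAt (hU.mem_nhds hz)), ← hβ,
      extDeriv_pull hα hW hU hΨ hz (hΨW hz), flat_pull, hαc _ (hΨW hz)]
    exact congrArg (fun l : E →L[ℝ] E →L[ℝ] ℝ => l (tderiv I Ψ z A) (tderiv I Ψ z B))
      (flatL (E := E)).map_zero
  -- `β = Ψ^*α` is closed, so its derivative is symmetric and it has a primitive on the convex set.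
  -- Then `α = (Ψ ∘ Φ)^*α = Φ^*dg = d(g ∘ Φ)`, which needs only `Ψ ∘ Φ = id` on `W`.
  obtain ⟨g, hg⟩ := hUc.exists_forall_hasFDerivAt_of_fderiv_symmetric hU hβd hsymm
  have hgs : ContDiffOn ℝ ∞ g U := by
    rw [contDiffOn_infty_iff_fderiv_of_isOpen hU]
    exact ⟨fun z hz => (hg z hz).differentiableAt.differentiableWithinAt,
      hβs.congr fun z hz => (hg z hz).fderiv⟩
  refine ⟨g ∘ Φ, hgs.contMDiffOn.comp hΦ hΦU, fun p hp => ?_⟩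
  have hΦp : MDifferentiableAt I 𝓘(ℝ, E') Φ p :=
    (hΦ.contMDiffAt (hW.mem_nhds hp)).mdifferentiableAt (by simp)
  have hΨp : MDifferentiableAt 𝓘(ℝ, E') I Ψ (Φ p) :=
    (hΨ.contMDiffAt (hU.mem_nhds (hΦU hp))).mdifferentiableAt (by simp)
  have h1 : dFun I (g ∘ Φ) p = β (Φ p) ∘L cderiv I Φ p := by
    rw [← (hg _ (hΦU hp)).fderiv]
    exact cderiv_comp (hg _ (hΦU hp)).differentiableAt hΦp
  have h2 : tderiv I Ψ (Φ p) ∘L cderiv I Φ p = ContinuousLinearMap.id ℝ E := by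
    have h3 : Ψ ∘ Φ =ᶠ[𝓝 p] id := by
      filter_upwards [hW.mem_nhds hp] with x hx
      exact hΨΦ x hx
    have h4 := mfderiv_comp p hΨp hΦp
    rw [h3.mfderiv_eq, mfderiv_id] at h4
    exact h4.symm
  rw [h1]
  change α' p = α' (Ψ (Φ p)) ∘L (tderiv I Ψ (Φ p) ∘L cderiv I Φ p)
  rw [h2, hΨΦ p hp]
  rfl

end Poincare

/-! ### Canonical coordinates over an arbitrary chart of the base -/

section PhaseCharts

variable {M : Type*} [TopologicalSpace M] [ChartedSpace Plane M]
  {φ : OpenPartialHomeomorph M Plane}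

theorem tderiv_cderiv_of_mem_maximalAtlas (hφ : φ ∈ IsManifold.maximalAtlas (𝓡 2) ∞ M) {q : M}
    (hq : q ∈ φ.source) :
    tderiv (𝓡 2) φ.symm (φ q) ∘L cderiv (𝓡 2) φ q = ContinuousLinearMap.id ℝ Plane := by
  have h1 : φ.symm ∘ φ =ᶠ[𝓝 q] id := by
    filter_upwards [φ.open_source.mem_nhds hq] with x hx
    exact φ.left_inv hx
  have h2 := mfderiv_comp q
    (((contMDiffOn_symm_of_mem_maximalAtlas hφ).contMDiffAt
      (φ.open_target.mem_nhds (φ.map_source hq))).mdifferentiableAt (by simp))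
    (((contMDiffOn_of_mem_maximalAtlas hφ).contMDiffAt
      (φ.open_source.mem_nhds hq)).mdifferentiableAt (by simp))
  rw [h1.mfderiv_eq, mfderiv_id] at h2
  exact h2.symm

/-- The canonical coordinates `(q, p)` on the phase space given by a chart of the base. -/
def phaseCoord (φ : OpenPartialHomeomorph M Plane) (p : Phase M) : Plane × (Plane →L[ℝ] ℝ) :=
  (φ p.1, momentum p ∘L tderiv (𝓡 2) φ.symm (φ p.1))

/-- The inverse of `phaseCoord`. -/
def phaseCoordSymm (φ : OpenPartialHomeomorph M Plane) (z : Plane × (Plane →L[ℝ] ℝ)) : Phase M :=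
  phasePoint (φ.symm z.1) (z.2 ∘L cderiv (𝓡 2) φ (φ.symm z.1))

theorem phaseCoordSymm_phaseCoord (hφ : φ ∈ IsManifold.maximalAtlas (𝓡 2) ∞ M) {p : Phase M}
    (hp : p.1 ∈ φ.source) : phaseCoordSymm φ (phaseCoord φ p) = p := by
  have h : phaseCoordSymm φ (phaseCoord φ p) = phasePoint (φ.symm (φ p.1))
    (momentum p ∘L (tderiv (𝓡 2) φ.symm (φ p.1) ∘L cderiv (𝓡 2) φ (φ.symm (φ p.1)))) := rfl
  rw [h, φ.left_inv hp, tderiv_cderiv_of_mem_maximalAtlas hφ hp]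
  rfl

variable [IsManifold (𝓡 2) ∞ M]

theorem contMDiffOn_phaseCoordSymm (hφ : φ ∈ IsManifold.maximalAtlas (𝓡 2) ∞ M) :
    ContMDiffOn 𝓘(ℝ, Plane × (Plane →L[ℝ] ℝ)) phaseModel ∞ (phaseCoordSymm φ)
      (φ.target ×ˢ Set.univ) := by
  rintro z ⟨hz, -⟩
  refine ContMDiffAt.contMDiffWithinAt ?_
  have hs : ContMDiffAt 𝓘(ℝ, Plane × (Plane →L[ℝ] ℝ)) (𝓡 2) ∞
      (fun z : Plane × (Plane →L[ℝ] ℝ) => φ.symm z.1) z :=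
    ((contMDiffOn_symm_of_mem_maximalAtlas hφ).contMDiffAt
      (φ.open_target.mem_nhds hz)).comp z contDiffAt_fst.contMDiffAt
  refine contMDiffAt_phasePoint (f := fun z : Plane × (Plane →L[ℝ] ℝ) => φ.symm z.1)
    (a := fun z => z.2 ∘L cderiv (𝓡 2) φ (φ.symm z.1)) hs ?_
  rw [contMDiffAt_iff_contDiffAt]
  set q := φ.symm z.1 with hq
  have hqs := mem_extChartAt_source (I := 𝓡 2) q
  have hqφ : q ∈ φ.source := φ.map_target hz
  have hφs := contMDiffOn_of_mem_maximalAtlas hφ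
  have h1 : ContDiffAt ℝ ∞ (fun z : Plane × (Plane →L[ℝ] ℝ) =>
      extChartAt (𝓡 2) q (φ.symm z.1)) z := contDiffAt_chart_comp hs hqs
  have h2 : ContDiffAt ℝ ∞ (φ ∘ (extChartAt (𝓡 2) q).symm) (extChartAt (𝓡 2) q q) := by
    rw [← contMDiffAt_iff_contDiffAt]
    refine ContMDiffAt.comp _ (hφs.contMDiffAt (φ.open_source.mem_nhds ?_))
      (contMDiffAt_chart_symm (mem_extChartAt_target q))
    rwa [(extChartAt (𝓡 2) q).left_inv hqs]
  have h3 : ContDiffAt ℝ ∞ (fderiv ℝ (φ ∘ (extChartAt (𝓡 2) q).symm)) (extChartAt (𝓡 2) q q) :=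
    h2.fderiv_right (by simp)
  -- In the preferred chart `ψ` at `q` the fibre coordinate is `z.2 ∘ D(φ ∘ ψ⁻¹)`, so only a smooth
  -- change of charts intervenes.
  have h4 := contDiffAt_snd.clm_comp (ContDiffAt.comp z h3 h1)
  refine h4.congr_of_eventuallyEq ?_
  filter_upwards [hs.continuousAt.preimage_mem_nhds
    ((isOpen_extChartAt_source (I := 𝓡 2) q).mem_nhds hqs),
    hs.continuousAt.preimage_mem_nhds (φ.open_source.mem_nhds hqφ)] with w hw hwφ
  have hl := (extChartAt (𝓡 2) q).left_inv hw
  have h5 := fderiv_comp_eq (F := (extChartAt (𝓡 2) q).symm)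
    (z := extChartAt (𝓡 2) q (φ.symm w.1)) (φ := φ)
    ((hφs.contMDiffAt (φ.open_source.mem_nhds (by rwa [hl]))).mdifferentiableAt (by simp))
    (mdifferentiableAt_chart_symm ((extChartAt (𝓡 2) q).map_source hw))
  rw [hl] at h5
  exact congrArg (fun l : Plane →L[ℝ] Plane => w.2 ∘L l) h5.symm

theorem contMDiffOn_phaseCoord (hφ : φ ∈ IsManifold.maximalAtlas (𝓡 2) ∞ M) :
    ContMDiffOn phaseModel 𝓘(ℝ, Plane × (Plane →L[ℝ] ℝ)) ∞ (phaseCoord φ)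
      {p | p.1 ∈ φ.source} := by
  intro p hp
  refine ContMDiffAt.contMDiffWithinAt ?_
  have hφs := contMDiffOn_of_mem_maximalAtlas hφ
  have hφt := contMDiffOn_symm_of_mem_maximalAtlas hφ
  have h1 : ContMDiffAt phaseModel (𝓡 2) ∞ (fun x : Phase M => φ x.1) p :=
    ContMDiffAt.comp (g := φ) p (hφs.contMDiffAt (φ.open_source.mem_nhds hp))
      (contMDiff_phaseProj p)
  have hps := mem_extChartAt_source (I := 𝓡 2) p.1
  have h2 : ContMDiffAt phaseModel 𝓘(ℝ, Plane →L[ℝ] ℝ) ∞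
      (fun x : Phase M => (extChartAt phaseModel p x).2) p :=
    ContMDiffAt.comp p contDiff_snd.contMDiff.contMDiffAt
      (contMDiffAt_chart (mem_extChartAt_source p))
  have h3 : ContDiffAt ℝ ∞ (extChartAt (𝓡 2) p.1 ∘ φ.symm) (φ p.1) :=
    contDiffAt_chart_comp (hφt.contMDiffAt (φ.open_target.mem_nhds (φ.map_source hp)))
      (by rwa [φ.left_inv hp])
  have h4 : ContDiffAt ℝ ∞ (fderiv ℝ (extChartAt (𝓡 2) p.1 ∘ φ.symm)) (φ p.1) :=
    h3.fderiv_right (by simp)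
  -- Conversely, the momentum in `φ` is the preferred fibre coordinate composed with the derivative
  -- of the change from `φ` to the preferred chart.
  have h5 := h2.clm_comp (ContMDiffAt.comp p h4.contMDiffAt h1)
  refine (h1.prodMk_space h5).congr_of_eventuallyEq ?_
  have hc := (contMDiff_phaseProj (M := M)).continuous.continuousAt (x := p)
  filter_upwards [hc.preimage_mem_nhds ((isOpen_extChartAt_source (I := 𝓡 2) p.1).mem_nhds hps),
    hc.preimage_mem_nhds (φ.open_source.mem_nhds hp)] with x hx hxφ
  refine Prod.ext rfl ?_
  have hl := φ.left_inv hxφ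
  have hxt := φ.map_source hxφ
  have hcont := (φ.continuousAt_symm hxt)
  have hx' : φ.symm (φ x.1) ∈ (extChartAt (𝓡 2) p.1).source := by rwa [hl]
  have e : φ.symm =ᶠ[𝓝 (φ x.1)]
      (extChartAt (𝓡 2) p.1).symm ∘ (extChartAt (𝓡 2) p.1 ∘ φ.symm) := by
    filter_upwards [hcont.preimage_mem_nhds
      ((isOpen_extChartAt_source (I := 𝓡 2) p.1).mem_nhds hx')] with w hw
    exact ((extChartAt (𝓡 2) p.1).left_inv hw).symm
  have h6 := tderiv_comp (I := 𝓡 2) (F := (extChartAt (𝓡 2) p.1).symm)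
    (g := extChartAt (𝓡 2) p.1 ∘ φ.symm) (z := φ x.1)
    (mdifferentiableAt_chart_symm ((extChartAt (𝓡 2) p.1).map_source hx'))
    ((contDiffAt_chart_comp (hφt.contMDiffAt (φ.open_target.mem_nhds hxt))
      hx').differentiableAt (by simp))
  change momentum x ∘L tderiv (𝓡 2) φ.symm (φ x.1) = (extChartAt phaseModel p x).2 ∘L
    fderiv ℝ (extChartAt (𝓡 2) p.1 ∘ φ.symm) (φ x.1)
  rw [tderiv_congr e, h6, phase_extChartAt p hx]
  simp only [Function.comp_apply, hl, ContinuousLinearMap.comp_assoc]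

/-- Every point has a neighbourhood that is the domain of a chart with convex image. -/
theorem exists_convex_chart (q : M) :
    ∃ φ ∈ IsManifold.maximalAtlas (𝓡 2) ∞ M, q ∈ φ.source ∧ Convex ℝ φ.target := by
  let e := chartAt Plane q
  obtain ⟨r, hr, hball⟩ := Metric.isOpen_iff.1 e.open_target (e q) (mem_chart_target Plane q)
  -- The chart is restricted to the preimage of a ball, so that its image is that ball.
  let B : Set M := e.source ∩ e ⁻¹' Metric.ball (e q) r
  have hB : IsOpen B := e.isOpen_inter_preimage Metric.isOpen_ball
  have hqB : q ∈ B := ⟨mem_chart_source Plane q, Metric.mem_ball_self hr⟩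
  have hmem : e.restr B ∈ IsManifold.maximalAtlas (𝓡 2) ∞ M :=
    restr_mem_maximalAtlas (contDiffGroupoid ∞ (𝓡 2))
      (IsManifold.chart_mem_maximalAtlas q) hB
  have hsrc : (e.restr B).source = B := by
    rw [e.restr_source' B hB, Set.inter_eq_right]
    exact Set.inter_subset_left
  have htgt : (e.restr B).target = Metric.ball (e q) r := by
    rw [← (e.restr B).image_source_eq_target, hsrc]
    ext y
    constructor
    · rintro ⟨x, hx, rfl⟩
      exact hx.2
    · intro hy
      have hyt := hball hy
      have hys : e (e.symm y) = y := e.right_inv hyt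
      exact ⟨e.symm y, ⟨e.map_target hyt, by rwa [Set.mem_preimage, hys]⟩, hys⟩
  exact ⟨e.restr B, hmem, by rwa [hsrc], by rw [htgt]; exact convex_ball _ _⟩

theorem botD_closedOn {σ : DiffForm phaseModel (Phase M) 2} (hdiv : IsDivergentType σ)
    (W : Set (Phase M)) : (botD σ).toForm.ClosedOn W := fun x _ => congrFun hdiv x

theorem givesHitchinPairOn_of_firstDeRhamVanishes {σ : DiffForm phaseModel (Phase M) 2}
    (hσ : σ.SmoothOn Set.univ) (hdiv : IsDivergentType σ) {W : Set (Phase M)} (hW : IsOpen W)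
    (h : FirstDeRhamVanishes phaseModel W) : GivesHitchinPairOn σ W := by
  obtain ⟨g, hg, hα⟩ :=
    h (botD σ) ((botD_smoothOn hσ).mono (Set.subset_univ _)) (botD_closedOn hdiv W)
  exact givesHitchinPairOn_of_botD_eq hσ hW hg hα

/-- The canonical coordinates of `φ` parametrize the preimage of its domain by `φ.target ×ˢ univ`,
which is convex; hence the closed form `⊥dσ` is exact there. -/
theorem givesHitchinPairOn_of_convex_chart {σ : DiffForm phaseModel (Phase M) 2}
    (hσ : σ.SmoothOn Set.univ) (hdiv : IsDivergentType σ)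
    (hφ : φ ∈ IsManifold.maximalAtlas (𝓡 2) ∞ M) (hconv : Convex ℝ φ.target) :
    GivesHitchinPairOn σ {p | p.1 ∈ φ.source} := by
  have hW : IsOpen {p : Phase M | p.1 ∈ φ.source} :=
    φ.open_source.preimage (contMDiff_phaseProj (M := M)).continuous
  obtain ⟨g, hg, hα⟩ := exists_eq_dFun_of_convex hW (φ.open_target.prod isOpen_univ)
    (hconv.prod convex_univ) (contMDiffOn_phaseCoord hφ) (contMDiffOn_phaseCoordSymm hφ)
    (fun p hp => ⟨φ.map_source hp, Set.mem_univ _⟩) (fun z hz => φ.map_target hz.1)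
    (fun p hp => phaseCoordSymm_phaseCoord hφ hp)
    ((botD_smoothOn hσ).mono (Set.subset_univ _)) (botD_closedOn hdiv _)
  exact givesHitchinPairOn_of_botD_eq hσ hW hg hα

end PhaseCharts

end SMAE

end

theorem mainTheorem4 {M : Type*} [TopologicalSpace M] [ChartedSpace SMAE.Plane M]
    [IsManifold (𝓡 2) ∞ M] (σ : SMAE.DiffForm SMAE.phaseModel (SMAE.Phase M) 2)
    (hσ : σ.SmoothOn Set.univ) (hdiv : SMAE.IsDivergentType σ) :
    (∀ W : Set (SMAE.Phase M), IsOpen W →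
      (SMAE.FirstDeRhamVanishes SMAE.phaseModel W ∨
        ∃ φ ∈ IsManifold.maximalAtlas (𝓡 2) ∞ M,
          Convex ℝ φ.target ∧ W = {p | p.1 ∈ φ.source}) →
      SMAE.GivesHitchinPairOn σ W) ∧
    (∀ q : M, ∃ B : Set M, IsOpen B ∧ q ∈ B ∧ SMAE.GivesHitchinPairOn σ {p | p.1 ∈ B}) := by
  refine ⟨?_, fun q => ?_⟩
  · rintro W hW (h | ⟨φ, hφ, hconv, rfl⟩)
    · exact SMAE.givesHitchinPairOn_of_firstDeRhamVanishes hσ hdiv hW h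
    · exact SMAE.givesHitchinPairOn_of_convex_chart hσ hdiv hφ hconv
  · obtain ⟨φ, hφ, hq, hconv⟩ := SMAE.exists_convex_chart q
    exact ⟨φ.source, φ.open_source, hq,
      SMAE.givesHitchinPairOn_of_convex_chart hσ hdiv hφ hconv⟩
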